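/- **Unique prime decomposition.** Let HOmp be the minimal higher-order process calculus with parameterization. Its terms are $$P,Q ::= 0 \mid X \mid m(X).P \mid \overline{m}(Q) \mid P\,|\,Q \mid \langle X\rangle P \mid P\langle Q\rangle \mid \langle x\rangle P \mid P\langle n\rangle ,$$ where $X$ ranges over process variables and $m,n$ over names (name constants and name variables $x$); $m(X).P$ and $\langle X\rangle P$ bind $X$, $\langle x\rangle P$ binds $x$, and terms are taken modulo $\alpha$-conversion and may be open. All terms are well typed: names are sorted, every sort $s$ having a fixed type $\mathrm{ob}(s)$ of the terms carried by channels of sort $s$; types are $T ::= \diamond \mid T\to\diamond \mid s\to\diamond$ (non-abstractions, process abstractions with parameter of type $T$, name abstractions with parameter of sort $s$); every process variable has a type, there are infinitely many variables of each type and infinitely many name constants and name variables of each sort; parallel composition, prefixing and abstraction apply only to bodies of type $\diamond$, and applications and outputs must respect types. A *process* is a term of type $\diamond$. Structural congruence $\equiv$ is the smallest congruence on terms satisfying $(P|Q)|R\equiv P|(Q|R)$, $P|Q\equiv Q|P$, $P|0\equiv P$, $(\langle X\rangle P)\langle Q\rangle\equiv P\{Q/X\}$ and $(\langle x\rangle P)\langle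 m\rangle\equiv P\{m/x\}$. Transitions are generated by $m(X).P\xrightarrow{m(X)}P$; $\overline m(Q)\xrightarrow{\overline m(Q)}0$; $P|Q\xrightarrow{\lambda}P'|Q$ if $P\xrightarrow{\lambda}P'$ and the variable bound by $\lambda$, if any, is not free in $Q$; $P|Q\xrightarrow{\tau}P'|Q'\{A/X\}$ if $P\xrightarrow{\overline m(A)}P'$ and $Q\xrightarrow{m(X)}Q'$; the symmetric rules; and closure under $\equiv$ on both sides. Strong bisimilarity $\sim$ is the largest strong HO-IO bisimulation, i.e. the largest symmetric relation $\mathcal R$ between terms of the same type such that $P\,\mathcal R\,Q$ implies: (1) if $P$ is not an abstraction, neither is $Q$; (2) if $P=\langle Y\rangle A$, then $Q=\langle Y\rangle B$ with $A\,\mathcal R\,B$; (3) if $P=\langle y\rangle A$, then $Q=\langle y\rangle B$ with $A\,\mathcal R\,B$; (4) if $P\xrightarrow{\overline m(A)}P'$, then $Q\xrightarrow{\overline m(B)}Q'$ with $A\,\mathcal R\,B$ and $P'\,\mathcal R\,Q'$; (5) if $P\xrightarrow{m(X)}P'$, then $Q\xrightarrow{m(X)}Q'$ with $P'\,\mathcal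 R\,Q'$; (6) if $P\equiv X|P'$, then $Q\equiv X|Q'$ with $P'\,\mathcal R\,Q'$ (and, for a variable $X$ of abstraction type, if $P\equiv X$ then $Q\equiv X$); (7) if $P\equiv X\langle A\rangle|P'$, then $Q\equiv X\langle B\rangle|Q'$ with $A\,\mathcal R\,B$ and $P'\,\mathcal R\,Q'$; (8) if $P\equiv X\langle n\rangle|P'$, then $Q\equiv X\langle n\rangle|Q'$ with $P'\,\mathcal R\,Q'$. A process $P$ is *prime* if $P\not\sim 0$ and, for all processes $P_1,P_2$, $P\sim P_1|P_2$ implies $P_1\sim 0$ or $P_2\sim 0$. A *prime decomposition* of $P$ is a product $\prod_{i=1}^n P_i=P_1|\cdots|P_n$ ($n\ge 0$, the empty product being $0$) of prime processes $P_i$ with $P\sim\prod_{i=1}^n P_i$. Then every process $P$ has a prime decomposition. Moreover, if $\prod_{i=1}^n P_i$ and $\prod_{j=1}^m Q_j$ are two prime decompositions of $P$, then $n=m$ and there is a permutation $\sigma$ of $\{1,\dots,n\}$ such that $P_i\sim Q_{\sigma(i)}$ for each $i\in\{1,\dots,n\}$. -/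

import Mathlib

universe u

namespace HOmp

/-- The types of terms over a set `S` of name sorts: `proc` is the type of non-abstractions,
`pabs T` the type of process abstractions whose parameter has type `T`, and `nabs s` the type of
name abstractions whose parameter is a name of sort `s`.  Types are finite trees, so all
abstractions have finite order. -/
inductive Ty (S : Type u) : Type u
  | proc : Ty S
  | pabs (T : Ty S) : Ty S
  | nabs (s : S) : Ty S

/-- Names of sort `s`: name constants and name variables (de Bruijn indices, one numbering for
each sort). -/
inductive Nm {S : Type u} (s : S) : Type
  | const (i : ℕ) : Nm s
  | var (i : ℕ) : Nm s

/-- Well-typed terms modulo `α`-conversion.  The sorting `ob` says that channels of sort `s` carry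
terms of type `ob s`.  For every type `T` there are infinitely many process variables
`var 0, var 1, …` of type `T`, and for every sort infinitely many name variables; they are de Bruijn
indices, numbered separately for each type and each sort, and a binder of type `T` (sort `s`)
affects the indices of type `T` (sort `s`) only.  Indices that exceed the number of enclosing
binders of their type are free variables, so terms may be open. -/
inductive Tm {S : Type u} (ob : S → Ty S) : Ty S → Type u
  /-- `0` -/
  | nil : Tm ob .proc
  /-- a process variable `X` of type `T` -/
  | var {T : Ty S} (i : ℕ) : Tm ob T
  /-- `m(X).P`, binding the variable `0` of type `ob s` in `P` -/
  | inp {s : S} (m : Nm s) (P : Tm ob .proc) : Tm ob .proc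
  /-- the output of `Q` on `m` -/
  | out {s : S} (m : Nm s) (Q : Tm ob (ob s)) : Tm ob .proc
  /-- `P | Q` -/
  | par (P Q : Tm ob .proc) : Tm ob .proc
  /-- `⟨X⟩P`, binding the variable `0` of type `T` in `P` -/
  | pabs {T : Ty S} (P : Tm ob .proc) : Tm ob (.pabs T)
  /-- `F⟨A⟩` -/
  | papp {T : Ty S} (F : Tm ob (.pabs T)) (A : Tm ob T) : Tm ob .proc
  /-- `⟨x⟩P`, binding the name variable `0` of sort `s` in `P` -/
  | nabs {s : S} (P : Tm ob .proc) : Tm ob (.nabs s)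
  /-- `F⟨n⟩` -/
  | napp {s : S} (F : Tm ob (.nabs s)) (n : Nm s) : Tm ob .proc

/-- Processes: the (possibly open) terms that are not abstractions. -/
abbrev Proc {S : Type u} (ob : S → Ty S) : Type u := Tm ob .proc

section Substitution

variable {S : Type u} {ob : S → Ty S}

/-- Renamings of indices, for an index set `K` of types or of sorts. -/
abbrev Ren (K : Type u) : Type u := K → ℕ → ℕ

/-- The identity renaming. -/
def Ren.id {K : Type u} : Ren K := fun _ i => i

open Classical in
/-- The renaming that makes room for a new variable `0` of kind `k`. -/
noncomputable def Ren.shift {K : Type u} (k : K) : Ren K :=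
  fun k' i => if k' = k then i + 1 else i

open Classical in
/-- Lifting of a renaming under a binder of kind `k`. -/
noncomputable def Ren.lift {K : Type u} (k : K) (r : Ren K) : Ren K := fun k' i =>
  if k' = k then
    match i with
    | 0 => 0
    | j + 1 => r k' j + 1
  else r k' i

/-- Replacement of the name variables in a name. -/
def Nm.subst {s : S} (w : ∀ s : S, ℕ → Nm s) : Nm s → Nm s
  | .const i => .const i
  | .var i => w s i

/-- Renaming of the name variable in a name. -/
def Nm.rename {s : S} (r : Ren S) : Nm s → Nm s
  | .const i => .const i
  | .var i => .var (r s i)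

/-- Simultaneous renaming of process variables (by `p`) and of name variables (by `r`). -/
noncomputable def Tm.rename : {T : Ty S} → Ren (Ty S) → Ren S → Tm ob T → Tm ob T
  | _, _, _, .nil => .nil
  | T, p, _, .var i => .var (p T i)
  | _, p, r, .inp (s := s) m P => .inp (m.rename r) (P.rename (p.lift (ob s)) r)
  | _, p, r, .out m Q => .out (m.rename r) (Q.rename p r)
  | _, p, r, .par P Q => .par (P.rename p r) (Q.rename p r)
  | _, p, r, .pabs (T := T) P => .pabs (P.rename (p.lift T) r)
  | _, p, r, .papp F A => .papp (F.rename p r) (A.rename p r)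
  | _, p, r, .nabs (s := s) P => .nabs (P.rename p (r.lift s))
  | _, p, r, .napp F n => .napp (F.rename p r) (n.rename r)

/-- Weakening by a new process variable `0` of type `T`. -/
noncomputable def Tm.weaken (T : Ty S) {U : Ty S} (P : Tm ob U) : Tm ob U :=
  P.rename (Ren.shift T) Ren.id

/-- Weakening by a new name variable `0` of sort `s`. -/
noncomputable def Tm.nweaken (s : S) {U : Ty S} (P : Tm ob U) : Tm ob U :=
  P.rename Ren.id (Ren.shift s)

open Classical in
/-- Lifting of a substitution for process variables under a binder of type `T`. -/
noncomputable def liftSub (T : Ty S) (v : ∀ U : Ty S, ℕ → Tm ob U) : ∀ U : Ty S, ℕ → Tm ob U :=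
  fun U i =>
    if U = T then
      match i with
      | 0 => .var 0
      | j + 1 => (v U j).weaken T
    else (v U i).weaken T

open Classical in
/-- Lifting of a substitution for name variables under a binder of sort `s`. -/
noncomputable def liftNSub (s : S) (w : ∀ t : S, ℕ → Nm t) : ∀ t : S, ℕ → Nm t :=
  fun t i =>
    if t = s then
      match i with
      | 0 => .var 0
      | j + 1 => (w t j).rename (Ren.shift s)
    else (w t i).rename (Ren.shift s)

/-- Simultaneous capture-avoiding substitution of terms for process variables (by `v`) and of names
for name variables (by `w`). -/
noncomputable def Tm.subst :
    {T : Ty S} → (∀ U : Ty S, ℕ → Tm ob U) → (∀ t : S, ℕ → Nm t) → Tm ob T → Tm ob T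
  | _, _, _, .nil => .nil
  | T, v, _, .var i => v T i
  | _, v, w, .inp (s := s) m P => .inp (m.subst w) (P.subst (liftSub (ob s) v) w)
  | _, v, w, .out m Q => .out (m.subst w) (Q.subst v w)
  | _, v, w, .par P Q => .par (P.subst v w) (Q.subst v w)
  | _, v, w, .pabs (T := T) P => .pabs (P.subst (liftSub T v) w)
  | _, v, w, .papp F A => .papp (F.subst v w) (A.subst v w)
  | _, v, w, .nabs (s := s) P =>
      .nabs (P.subst (fun U i => (v U i).nweaken s) (liftNSub s w))
  | _, v, w, .napp F n => .napp (F.subst v w) (n.subst w)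

open Classical in
/-- `P{A/X}`, where `X` is the variable `0` of type `T`, which disappears. -/
noncomputable def Tm.inst {T U : Ty S} (P : Tm ob U) (A : Tm ob T) : Tm ob U :=
  P.subst
    (fun V i =>
      if h : V = T then
        match i with
        | 0 => h ▸ A
        | j + 1 => .var j
      else .var i)
    (fun _ i => .var i)

open Classical in
/-- `P{n/x}`, where `x` is the name variable `0` of sort `s`, which disappears. -/
noncomputable def Tm.ninst {s : S} {U : Ty S} (P : Tm ob U) (n : Nm s) : Tm ob U :=
  P.subst (fun _ i => .var i)
    (fun t i =>
      if h : t = s then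
        match i with
        | 0 => h ▸ n
        | j + 1 => .var j
      else .var i)

end Substitution

section Semantics

variable {S : Type u} {ob : S → Ty S}

/-- Structural congruence: the smallest congruence on terms that contains the commutative monoid
laws of parallel composition and the two laws of application. -/
inductive SC : {T : Ty S} → Tm ob T → Tm ob T → Prop
  | refl {T : Ty S} (P : Tm ob T) : SC P P
  | symm {T : Ty S} {P Q : Tm ob T} : SC P Q → SC Q P
  | trans {T : Ty S} {P Q R : Tm ob T} : SC P Q → SC Q R → SC P R
  | inp {s : S} (m : Nm s) {P Q : Proc ob} : SC P Q → SC (.inp m P) (.inp m Q)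
  | out {s : S} (m : Nm s) {A B : Tm ob (ob s)} : SC A B → SC (.out m A) (.out m B)
  | par {P P' Q Q' : Proc ob} : SC P P' → SC Q Q' → SC (.par P Q) (.par P' Q')
  | pabs {T : Ty S} {P Q : Proc ob} : SC P Q → SC (.pabs (T := T) P) (.pabs Q)
  | papp {T : Ty S} {F G : Tm ob (.pabs T)} {A B : Tm ob T} :
      SC F G → SC A B → SC (.papp F A) (.papp G B)
  | nabs {s : S} {P Q : Proc ob} : SC P Q → SC (.nabs (s := s) P) (.nabs Q)
  | napp {s : S} {F G : Tm ob (.nabs s)} (n : Nm s) : SC F G → SC (.napp F n) (.napp G n)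
  | par_assoc (P Q R : Proc ob) : SC (.par (.par P Q) R) (.par P (.par Q R))
  | par_comm (P Q : Proc ob) : SC (.par P Q) (.par Q P)
  | par_nil (P : Proc ob) : SC (.par P .nil) P
  | papp_pabs {T : Ty S} (P : Proc ob) (A : Tm ob T) : SC (.papp (.pabs P) A) (P.inst A)
  | napp_nabs {s : S} (P : Proc ob) (n : Nm s) : SC (.napp (.nabs P) n) (P.ninst n)

/-- Actions.  The bound variable of an input action on a channel of sort `s` is the variable `0` of
type `ob s` of the target of the transition. -/
inductive Act (ob : S → Ty S) : Type u
  | inp {s : S} (m : Nm s) : Act ob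
  | out {s : S} (m : Nm s) (A : Tm ob (ob s)) : Act ob
  | tau : Act ob

/-- What a parallel component that does not take part in an action becomes: the same term, in which
the variable bound by an input action does not occur. -/
noncomputable def Act.frame : Act ob → Proc ob → Proc ob
  | .inp (s := s) _, Q => Q.weaken (ob s)
  | .out _ _, Q => Q
  | .tau, Q => Q

/-- The labelled transition system on open terms (with late instantiation of inputs). -/
inductive Step : Act ob → Proc ob → Proc ob → Prop
  | inp {s : S} (m : Nm s) (P : Proc ob) : Step (.inp m) (.inp m P) P
  | out {s : S} (m : Nm s) (A : Tm ob (ob s)) : Step (.out m A) (.out m A) .nil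
  | parL {a : Act ob} {P P' : Proc ob} (Q : Proc ob) :
      Step a P P' → Step a (.par P Q) (.par P' (a.frame Q))
  | parR {a : Act ob} {Q Q' : Proc ob} (P : Proc ob) :
      Step a Q Q' → Step a (.par P Q) (.par (a.frame P) Q')
  | comL {s : S} {m : Nm s} {A : Tm ob (ob s)} {P P' Q Q' : Proc ob} :
      Step (.out m A) P P' → Step (.inp m) Q Q' → Step .tau (.par P Q) (.par P' (Q'.inst A))
  | comR {s : S} {m : Nm s} {A : Tm ob (ob s)} {P P' Q Q' : Proc ob} :
      Step (.inp m) P P' → Step (.out m A) Q Q' → Step .tau (.par P Q) (.par (P'.inst A) Q')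
  | struct {a : Act ob} {P P' Q Q' : Proc ob} :
      SC Q P → Step a P P' → SC P' Q' → Step a Q Q'

/-- The term is syntactically an abstraction. -/
def Tm.IsAbs : {T : Ty S} → Tm ob T → Prop
  | _, .pabs _ => True
  | _, .nabs _ => True
  | _, _ => False

/-- Strong HO-IO bisimulations.  Bisimilar terms have the same type, so only relations between terms
of the same type are considered.  The clause for a free variable `X` at top level reads
`P ≡ X | P'` when `X` is a non-abstraction.  A variable of abstraction type cannot be composed in
parallel and stands alone (`P ≡ X`); this is `var_abs`. -/
structure IsHOIOBisimulation (R : ∀ ⦃T : Ty S⦄, Tm ob T → Tm ob T → Prop) : Prop where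
  symm : ∀ ⦃T : Ty S⦄ ⦃P Q : Tm ob T⦄, R P Q → R Q P
  non_abs : ∀ ⦃T : Ty S⦄ ⦃P Q : Tm ob T⦄, R P Q → ¬ P.IsAbs → ¬ Q.IsAbs
  pabs : ∀ ⦃T : Ty S⦄ ⦃A : Proc ob⦄ ⦃Q : Tm ob (.pabs T)⦄, R (.pabs A) Q →
    ∃ B : Proc ob, Q = .pabs B ∧ R A B
  nabs : ∀ ⦃s : S⦄ ⦃A : Proc ob⦄ ⦃Q : Tm ob (.nabs s)⦄, R (.nabs A) Q →
    ∃ B : Proc ob, Q = .nabs B ∧ R A B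
  out : ∀ ⦃P Q : Proc ob⦄, R P Q → ∀ ⦃s : S⦄ (m : Nm s) (A : Tm ob (ob s)) (P' : Proc ob),
    Step (.out m A) P P' →
      ∃ (B : Tm ob (ob s)) (Q' : Proc ob), Step (.out m B) Q Q' ∧ R A B ∧ R P' Q'
  inp : ∀ ⦃P Q : Proc ob⦄, R P Q → ∀ ⦃s : S⦄ (m : Nm s) (P' : Proc ob),
    Step (.inp m) P P' → ∃ Q' : Proc ob, Step (.inp m) Q Q' ∧ R P' Q'
  var : ∀ ⦃P Q : Proc ob⦄, R P Q → ∀ (i : ℕ) (P' : Proc ob),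
    SC P (.par (.var i) P') → ∃ Q' : Proc ob, SC Q (.par (.var i) Q') ∧ R P' Q'
  var_abs : ∀ ⦃T : Ty S⦄, T ≠ .proc → ∀ ⦃P Q : Tm ob T⦄, R P Q → ∀ i : ℕ,
    SC P (.var i) → SC Q (.var i)
  papp : ∀ ⦃P Q : Proc ob⦄, R P Q → ∀ ⦃T : Ty S⦄ (i : ℕ) (A : Tm ob T) (P' : Proc ob),
    SC P (.par (.papp (.var i) A) P') →
      ∃ (B : Tm ob T) (Q' : Proc ob), SC Q (.par (.papp (.var i) B) Q') ∧ R A B ∧ R P' Q'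
  napp : ∀ ⦃P Q : Proc ob⦄, R P Q → ∀ ⦃s : S⦄ (i : ℕ) (n : Nm s) (P' : Proc ob),
    SC P (.par (.napp (.var i) n) P') →
      ∃ Q' : Proc ob, SC Q (.par (.napp (.var i) n) Q') ∧ R P' Q'

/-- Strong (HO-IO) bisimilarity: the union of all strong HO-IO bisimulations. -/
def Bisim {T : Ty S} (P Q : Tm ob T) : Prop :=
  ∃ R : ∀ ⦃U : Ty S⦄, Tm ob U → Tm ob U → Prop, IsHOIOBisimulation R ∧ R P Q

/-- `P₁ | P₂ | ⋯ | Pₖ`; the empty product is `0`. -/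
def parList : List (Proc ob) → Proc ob
  | [] => .nil
  | [P] => P
  | P :: Q :: L => .par P (parList (Q :: L))

/-- Prime processes. -/
def IsPrime (P : Proc ob) : Prop :=
  ¬ Bisim P .nil ∧
    ∀ P₁ P₂ : Proc ob, Bisim P (.par P₁ P₂) → Bisim P₁ .nil ∨ Bisim P₂ .nil

/-- The product of the family `Ps` is a prime decomposition of `P`. -/
def IsPrimeDecomposition (P : Proc ob) {n : ℕ} (Ps : Fin n → Proc ob) : Prop :=
  (∀ i, IsPrime (Ps i)) ∧ Bisim P (parList (List.ofFn Ps))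

end Semantics

end HOmp

/-!
Modulo structural congruence a process is a finite multiset of components: prefixes, outputs, and
variables that stand alone or are applied. This normal form is obtained by evaluating terms in a
model, where `β`-reduction becomes an equality. Hence every observation of `P | Q` consumes a
component of `P` or a component of `Q`, and processes modulo bisimilarity form a commutative monoid
under parallel composition. The size of the normal form is additive, drops with every observation
and is invariant under bisimilarity; prime decompositions exist by induction on it.

Uniqueness is also by induction on the size. Suppose that two different multisets `s` and `t` of
primes have the same product. Let `c` be a prime of maximal size among those with different
multiplicities in `s` and `t`, say with a larger multiplicity in `s`. If `s` contains a prime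
`a ≠ c`, let `a` act; `t` answers with an action of some prime `b`. What remains on the two sides is
smaller, hence uniquely decomposed, and comparing the multiplicities of `c` shows that the residual
of `b` has more copies of `c` than the residual of `a`. So `b` is larger than `c` and therefore
occurs in `s` as well; letting it act in turn gives residuals with ever more copies of `c`, which is
impossible. Thus `s` consists of copies of `c` only, and the primes of `t` are at most as large as
`c`. When a prime `b` of `t` acts, its residual does not contain `c`, while `s` answers with `c`;
counting `c` again shows that `c` does not occur in `t` and occurs only once in `s`. So `c` is the
product of the primes of `t`, and being prime it is one of them: a contradiction.
-/

namespace HOmp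

/-! ### Substitution -/

section Environments

variable {J : Type u} {K L : J → Type*}

/-- Environments, which assign a value of kind `j` to every variable of kind `j`: substitutions for
process variables, substitutions for name variables, and semantic environments. -/
abbrev Env (K : J → Type*) : Type _ := ∀ j, ℕ → K j

theorem Env.ext_at (k : J) {v v' : Env K} (h0 : v k 0 = v' k 0)
    (hs : ∀ n, v k (n + 1) = v' k (n + 1)) (hne : ∀ j, j ≠ k → ∀ i, v j i = v' j i) : v = v' := by
  funext j i
  by_cases h : j = k
  · subst h
    cases i with
    | zero => exact h0
    | succ n => exact hs n
  · exact hne j h i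

open Classical in
/-- Extension of an environment by a new value at index `0` of kind `k`; the old values of kind `k`
move up by one. -/
noncomputable def cons (k : J) (a : K k) (v : Env K) : Env K := fun j i =>
  if h : j = k then
    match i with
    | 0 => h ▸ a
    | n + 1 => v j n
  else v j i

@[simp] theorem cons_zero (k : J) (a : K k) (v : Env K) : cons k a v k 0 = a := by
  simp [cons]

@[simp] theorem cons_succ (k : J) (a : K k) (v : Env K) (n : ℕ) :
    cons k a v k (n + 1) = v k n := by
  simp [cons]

theorem cons_of_ne {k j : J} (h : j ≠ k) (a : K k) (v : Env K) (i : ℕ) :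
    cons k a v j i = v j i := by
  simp [cons, h]

theorem rel_cons {R : ∀ j, K j → L j → Prop} {k : J} {a : K k} {b : L k} {v : Env K} {w : Env L}
    (h : R k a b) (hvw : ∀ j i, R j (v j i) (w j i)) (j : J) (i : ℕ) :
    R j (cons k a v j i) (cons k b w j i) := by
  by_cases hj : j = k
  · subst hj
    cases i <;> simp [h, hvw]
  · simp only [cons_of_ne hj, hvw]

theorem map_cons (f : ∀ j, K j → L j) (k : J) (a : K k) (v : Env K) :
    (fun j i => f j (cons k a v j i)) = cons k (f k a) (fun j i => f j (v j i)) := by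
  refine Env.ext_at k ?_ ?_ ?_ <;> simp +contextual [cons_of_ne]

theorem cons_shift (k : J) (a : K k) (v : Env K) (j : J) (i : ℕ) :
    cons k a v j (Ren.shift k j i) = v j i := by
  by_cases h : j = k
  · subst h
    simp [Ren.shift]
  · simp [Ren.shift, h, cons_of_ne h]

theorem cons_lift (k : J) (a : K k) (v : Env K) (r : Ren J) :
    (fun j i => cons k a v j (r.lift k j i)) = cons k a (fun j i => v j (r j i)) := by
  refine Env.ext_at k ?_ ?_ ?_ <;> simp +contextual [Ren.lift, cons_of_ne]

theorem cons_self_shift (k : J) (v : Env K) :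
    cons k (v k 0) (fun j i => v j (Ren.shift k j i)) = v := by
  refine Env.ext_at k ?_ ?_ ?_ <;> simp +contextual [Ren.shift, cons_of_ne]

theorem Ren.lift_zero (k : J) (r : Ren J) : r.lift k k 0 = 0 := by
  simp [Ren.lift]

theorem Ren.lift_eq_cons (k : J) (r : Ren J) :
    r.lift k = cons (K := fun _ => ℕ) k 0 (fun j i => Ren.shift k j (r j i)) := by
  refine Env.ext_at (K := fun _ => ℕ) k ?_ ?_ ?_ <;>
    simp +contextual [Ren.lift, Ren.shift, cons_of_ne]

theorem Ren.lift_shift (k : J) (r : Ren J) (j : J) (i : ℕ) :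
    r.lift k j (Ren.shift k j i) = Ren.shift k j (r j i) := by
  rw [Ren.lift_eq_cons, cons_shift (K := fun _ => ℕ)]

theorem Ren.lift_id (k : J) : Ren.lift k Ren.id = Ren.id := by
  rw [Ren.lift_eq_cons]
  exact cons_self_shift (K := fun _ => ℕ) k Ren.id

end Environments

section SubstitutionLemmas

variable {S : Type u} {ob : S → Ty S}

theorem liftSub_eq_cons (T : Ty S) (v : Env (Tm ob)) :
    liftSub T v = cons T (.var 0) (fun U i => (v U i).weaken T) := by
  refine Env.ext_at T ?_ ?_ ?_ <;> simp +contextual [liftSub, cons_of_ne]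

theorem liftNSub_eq_cons (s : S) (w : Env (@Nm S)) :
    liftNSub s w = cons s (.var 0) (fun t i => (w t i).rename (Ren.shift s)) := by
  refine Env.ext_at s ?_ ?_ ?_ <;> simp +contextual [liftNSub, cons_of_ne]

theorem Tm.inst_eq {T U : Ty S} (P : Tm ob U) (A : Tm ob T) :
    P.inst A = P.subst (cons T A fun _ i => .var i) (fun _ i => .var i) :=
  rfl

theorem Tm.ninst_eq {s : S} {U : Ty S} (P : Tm ob U) (n : Nm s) :
    P.ninst n = P.subst (fun _ i => .var i) (cons s n fun _ i => .var i) :=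
  rfl

theorem Nm.rename_rename {s : S} (r r' : Ren S) (m : Nm s) :
    (m.rename r).rename r' = m.rename (fun s i => r' s (r s i)) := by
  cases m <;> rfl

theorem Nm.rename_eq_subst {s : S} (r : Ren S) (m : Nm s) :
    m.rename r = m.subst (fun s i => .var (r s i)) := by
  cases m <;> rfl

theorem Nm.subst_rename {s : S} (r : Ren S) (w : Env (@Nm S)) (m : Nm s) :
    (m.rename r).subst w = m.subst (fun s i => w s (r s i)) := by
  cases m <;> rfl

theorem Nm.subst_subst {s : S} (w w' : Env (@Nm S)) (m : Nm s) :
    (m.subst w).subst w' = m.subst (fun s i => (w s i).subst w') := by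
  cases m <;> rfl

theorem Nm.rename_subst {s : S} (r : Ren S) (w : Env (@Nm S)) (m : Nm s) :
    (m.subst w).rename r = m.subst (fun s i => (w s i).rename r) := by
  cases m <;> rfl

theorem Nm.subst_id {s : S} (m : Nm s) : m.subst (fun _ i => .var i) = m := by
  cases m <;> rfl

theorem liftSub_var (T : Ty S) (p : Ren (Ty S)) :
    liftSub T (fun U i => (.var (p U i) : Tm ob U)) = fun U i => .var (p.lift T U i) := by
  rw [liftSub_eq_cons, Ren.lift_eq_cons, map_cons (K := fun _ => ℕ) (fun U i => (.var i : Tm ob U))]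
  rfl

theorem liftNSub_var (s : S) (r : Ren S) :
    liftNSub s (fun t i => (.var (r t i) : Nm t)) = fun t i => .var (r.lift s t i) := by
  rw [liftNSub_eq_cons, Ren.lift_eq_cons, map_cons (K := fun _ => ℕ) (fun t i => (.var i : Nm t))]
  rfl

theorem Tm.rename_eq_subst {T : Ty S} (P : Tm ob T) (p : Ren (Ty S)) (r : Ren S) :
    P.rename p r = P.subst (fun U i => .var (p U i)) (fun t i => .var (r t i)) := by
  induction P generalizing p r with
  | nil => rfl
  | var i => rfl
  | inp m P ih => simp only [rename, subst, ih, Nm.rename_eq_subst, liftSub_var]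
  | out m Q ih => simp only [rename, subst, ih, Nm.rename_eq_subst]
  | par P Q ihP ihQ => simp only [rename, subst, ihP, ihQ]
  | pabs P ih => simp only [rename, subst, ih, liftSub_var]
  | papp F A ihF ihA => simp only [rename, subst, ihF, ihA]
  | nabs P ih => simp only [rename, subst, ih, liftNSub_var, nweaken, Ren.id]
  | napp F n ih => simp only [rename, subst, ih, Nm.rename_eq_subst]

theorem liftSub_lift (T : Ty S) (p : Ren (Ty S)) (v : Env (Tm ob)) :
    (fun U i => liftSub T v U (p.lift T U i)) = liftSub T (fun U i => v U (p U i)) := by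
  simp only [liftSub_eq_cons, cons_lift]

theorem liftNSub_lift (s : S) (r : Ren S) (w : Env (@Nm S)) :
    (fun t i => liftNSub s w t (r.lift s t i)) = liftNSub s (fun t i => w t (r t i)) := by
  simp only [liftNSub_eq_cons, cons_lift]

theorem Tm.subst_rename {T : Ty S} (P : Tm ob T) (p : Ren (Ty S)) (r : Ren S)
    (v : Env (Tm ob)) (w : Env (@Nm S)) :
    (P.rename p r).subst v w = P.subst (fun U i => v U (p U i)) (fun t i => w t (r t i)) := by
  induction P generalizing p r v w with
  | nil => rfl
  | var i => rfl
  | inp m P ih => simp only [rename, subst, ih, Nm.subst_rename, liftSub_lift]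
  | out m Q ih => simp only [rename, subst, ih, Nm.subst_rename]
  | par P Q ihP ihQ => simp only [rename, subst, ihP, ihQ]
  | pabs P ih => simp only [rename, subst, ih, liftSub_lift]
  | papp F A ihF ihA => simp only [rename, subst, ihF, ihA]
  | nabs P ih => simp only [rename, subst, ih, liftNSub_lift]
  | napp F n ih => simp only [rename, subst, ih, Nm.subst_rename]

theorem Tm.rename_rename {T : Ty S} (P : Tm ob T) (p p' : Ren (Ty S)) (r r' : Ren S) :
    (P.rename p r).rename p' r' =
      P.rename (fun U i => p' U (p U i)) (fun t i => r' t (r t i)) := by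
  rw [rename_eq_subst (P.rename p r), subst_rename, ← rename_eq_subst]

theorem Tm.rename_weaken {T U : Ty S} (P : Tm ob U) (p : Ren (Ty S)) (r : Ren S) :
    (P.weaken T).rename (p.lift T) r = (P.rename p r).weaken T := by
  simp only [weaken, rename_rename, Ren.lift_shift, Ren.id]

theorem Tm.rename_nweaken {s : S} {U : Ty S} (P : Tm ob U) (p : Ren (Ty S)) (r : Ren S) :
    (P.nweaken s).rename p (r.lift s) = (P.rename p r).nweaken s := by
  simp only [nweaken, rename_rename, Ren.lift_shift, Ren.id]

theorem rename_liftSub (T : Ty S) (p : Ren (Ty S)) (r : Ren S) (v : Env (Tm ob)) :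
    (fun U i => (liftSub T v U i).rename (p.lift T) r) =
      liftSub T (fun U i => (v U i).rename p r) := by
  simp only [liftSub_eq_cons]
  rw [map_cons (fun U (P : Tm ob U) => P.rename (p.lift T) r)]
  simp only [Tm.rename_weaken, Tm.rename, Ren.lift_zero]

theorem rename_liftNSub (s : S) (r : Ren S) (w : Env (@Nm S)) :
    (fun t i => (liftNSub s w t i).rename (r.lift s)) =
      liftNSub s (fun t i => (w t i).rename r) := by
  simp only [liftNSub_eq_cons]
  rw [map_cons (fun t (m : Nm t) => m.rename (r.lift s))]
  simp only [Nm.rename_rename, Ren.lift_shift]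
  simp only [Nm.rename, Ren.lift_zero]

theorem Tm.rename_subst {T : Ty S} (P : Tm ob T) (p : Ren (Ty S)) (r : Ren S)
    (v : Env (Tm ob)) (w : Env (@Nm S)) :
    (P.subst v w).rename p r =
      P.subst (fun U i => (v U i).rename p r) (fun t i => (w t i).rename r) := by
  induction P generalizing p r v w with
  | nil => rfl
  | var i => rfl
  | inp m P ih => simp only [rename, subst, ih, Nm.rename_subst, rename_liftSub]
  | out m Q ih => simp only [rename, subst, ih, Nm.rename_subst]
  | par P Q ihP ihQ => simp only [rename, subst, ihP, ihQ]
  | pabs P ih => simp only [rename, subst, ih, rename_liftSub]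
  | papp F A ihF ihA => simp only [rename, subst, ihF, ihA]
  | nabs P ih => simp only [rename, subst, ih, rename_liftNSub, rename_nweaken]
  | napp F n ih => simp only [rename, subst, ih, Nm.rename_subst]

theorem Tm.subst_weaken_cons {T U : Ty S} (P : Tm ob U) (A : Tm ob T)
    (v : Env (Tm ob)) (w : Env (@Nm S)) :
    (P.weaken T).subst (cons T A v) w = P.subst v w := by
  simp only [weaken, subst_rename, cons_shift, Ren.id]

theorem Tm.subst_nweaken_cons {s : S} {U : Ty S} (P : Tm ob U) (n : Nm s)
    (v : Env (Tm ob)) (w : Env (@Nm S)) :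
    (P.nweaken s).subst v (cons s n w) = P.subst v w := by
  simp only [nweaken, subst_rename, cons_shift, Ren.id]

theorem Tm.weaken_subst {T U : Ty S} (P : Tm ob U)
    (v : Env (Tm ob)) (w : Env (@Nm S)) :
    (P.weaken T).subst (liftSub T v) w = (P.subst v w).weaken T := by
  rw [liftSub_eq_cons, subst_weaken_cons, weaken, rename_subst]
  congr 1
  funext t i
  cases w t i <;> rfl

theorem Tm.nweaken_subst {s : S} {U : Ty S} (P : Tm ob U)
    (v : Env (Tm ob)) (w : Env (@Nm S)) :
    (P.nweaken s).subst (fun U i => (v U i).nweaken s) (liftNSub s w) =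
      (P.subst v w).nweaken s := by
  rw [liftNSub_eq_cons, subst_nweaken_cons, nweaken, rename_subst]
  rfl

theorem subst_liftSub (T : Ty S) (v v' : Env (Tm ob)) (w' : Env (@Nm S)) :
    (fun U i => (liftSub T v U i).subst (liftSub T v') w') =
      liftSub T (fun U i => (v U i).subst v' w') := by
  rw [liftSub_eq_cons T v, liftSub_eq_cons T (fun U i => (v U i).subst v' w'),
    map_cons (fun U (P : Tm ob U) => P.subst (liftSub T v') w')]
  simp only [Tm.weaken_subst]
  simp [Tm.subst, liftSub_eq_cons]

theorem subst_liftNSub (s : S) (w w' : Env (@Nm S)) :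
    (fun t i => (liftNSub s w t i).subst (liftNSub s w')) =
      liftNSub s (fun t i => (w t i).subst w') := by
  simp only [liftNSub_eq_cons]
  rw [map_cons (fun t (m : Nm t) => m.subst _)]
  simp only [Nm.subst_rename, cons_shift, Nm.rename_subst]
  simp [Nm.subst]

theorem Tm.subst_subst {T : Ty S} (P : Tm ob T) (v v' : Env (Tm ob))
    (w w' : Env (@Nm S)) :
    (P.subst v w).subst v' w' =
      P.subst (fun U i => (v U i).subst v' w') (fun t i => (w t i).subst w') := by
  induction P generalizing v v' w w' with
  | nil => rfl
  | var i => rfl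
  | inp m P ih => simp only [subst, ih, Nm.subst_subst, subst_liftSub]
  | out m Q ih => simp only [subst, ih, Nm.subst_subst]
  | par P Q ihP ihQ => simp only [subst, ihP, ihQ]
  | pabs P ih => simp only [subst, ih, subst_liftSub]
  | papp F A ihF ihA => simp only [subst, ihF, ihA]
  | nabs P ih => simp only [subst, ih, subst_liftNSub, nweaken_subst]
  | napp F n ih => simp only [subst, ih, Nm.subst_subst]

theorem Nm.rename_id {s : S} (m : Nm s) : m.rename Ren.id = m := by
  cases m <;> rfl

theorem Tm.rename_id {T : Ty S} (P : Tm ob T) : P.rename Ren.id Ren.id = P := by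
  induction P with
  | nil => rfl
  | var i => rfl
  | inp m P ih => simp only [rename, Ren.lift_id, ih, Nm.rename_id]
  | out m Q ih => simp only [rename, ih, Nm.rename_id]
  | par P Q ihP ihQ => simp only [rename, ihP, ihQ]
  | pabs P ih => simp only [rename, Ren.lift_id, ih]
  | papp F A ihF ihA => simp only [rename, ihF, ihA]
  | nabs P ih => simp only [rename, Ren.lift_id, ih]
  | napp F n ih => simp only [rename, ih, Nm.rename_id]

theorem Tm.subst_id {T : Ty S} (P : Tm ob T) :
    P.subst (fun _ i => .var i) (fun _ i => .var i) = P :=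
  (P.rename_eq_subst Ren.id Ren.id).symm.trans P.rename_id

theorem subst_liftSub_cons {T : Ty S} (A : Tm ob T) (v v' : Env (Tm ob)) (w : Env (@Nm S)) :
    (fun U i => (liftSub T v U i).subst (cons T A v') w) =
      cons T A fun U i => (v U i).subst v' w := by
  rw [liftSub_eq_cons, map_cons fun U (P : Tm ob U) => P.subst (cons T A v') w]
  simp only [Tm.subst_weaken_cons, Tm.subst, cons_zero]

theorem subst_liftNSub_cons {s : S} (n : Nm s) (w w' : Env (@Nm S)) :
    (fun t i => (liftNSub s w t i).subst (cons s n w')) =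
      cons s n fun t i => (w t i).subst w' := by
  rw [liftNSub_eq_cons, map_cons fun t (m : Nm t) => m.subst (cons s n w')]
  simp only [Nm.subst_rename, cons_shift]
  simp only [Nm.subst, cons_zero]

theorem Tm.inst_subst_liftSub {T U : Ty S} (P : Tm ob U) (A : Tm ob T) (v : Env (Tm ob))
    (w : Env (@Nm S)) : (P.subst (liftSub T v) w).inst A = P.subst (cons T A v) w := by
  simp only [inst_eq, subst_subst, subst_liftSub_cons, subst_id, Nm.subst_id]

theorem Tm.subst_inst {T U : Ty S} (P : Tm ob U) (A : Tm ob T) (v : Env (Tm ob))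
    (w : Env (@Nm S)) : (P.inst A).subst v w = P.subst (cons T (A.subst v w) v) w := by
  rw [inst_eq, subst_subst, map_cons fun U (P : Tm ob U) => P.subst v w]
  rfl

theorem Tm.ninst_subst_liftNSub {s : S} {U : Ty S} (P : Tm ob U) (n : Nm s) (v : Env (Tm ob))
    (w : Env (@Nm S)) :
    (P.subst (fun U i => (v U i).nweaken s) (liftNSub s w)).ninst n =
      P.subst v (cons s n w) := by
  simp only [ninst_eq, subst_subst, subst_liftNSub_cons, subst_nweaken_cons, subst_id, Nm.subst_id]

theorem Tm.subst_ninst {s : S} {U : Ty S} (P : Tm ob U) (n : Nm s) (v : Env (Tm ob))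
    (w : Env (@Nm S)) : (P.ninst n).subst v w = P.subst v (cons s (n.subst w) w) := by
  rw [ninst_eq, subst_subst, map_cons fun t (m : Nm t) => m.subst w]
  rfl

theorem SC.subst {T : Ty S} {P Q : Tm ob T} (h : SC P Q) (v : Env (Tm ob))
    (w : Env (@Nm S)) : SC (P.subst v w) (Q.subst v w) := by
  induction h generalizing v w with
  | refl P => exact .refl _
  | symm _ ih => exact .symm (ih v w)
  | trans _ _ ih₁ ih₂ => exact .trans (ih₁ v w) (ih₂ v w)
  | inp m _ ih => exact .inp _ (ih _ _)
  | out m _ ih => exact .out _ (ih _ _)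
  | par _ _ ih₁ ih₂ => exact .par (ih₁ _ _) (ih₂ _ _)
  | pabs _ ih => exact .pabs (ih _ _)
  | papp _ _ ih₁ ih₂ => exact .papp (ih₁ _ _) (ih₂ _ _)
  | nabs _ ih => exact .nabs (ih _ _)
  | napp n _ ih => exact .napp _ (ih _ _)
  | par_assoc P Q R => exact .par_assoc _ _ _
  | par_comm P Q => exact .par_comm _ _
  | par_nil P => exact .par_nil _
  | papp_pabs P A =>
    rw [Tm.subst_inst, ← Tm.inst_subst_liftSub]
    exact .papp_pabs _ _
  | napp_nabs P n =>
    rw [Tm.subst_ninst, ← Tm.ninst_subst_liftNSub]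
    exact .napp_nabs _ _

theorem SC.rename {T : Ty S} {P Q : Tm ob T} (h : SC P Q) (p : Ren (Ty S)) (r : Ren S) :
    SC (P.rename p r) (Q.rename p r) := by
  simp only [Tm.rename_eq_subst]
  exact h.subst _ _

theorem SC.liftSub {v v' : Env (Tm ob)} (h : ∀ U i, SC (v U i) (v' U i)) (T U : Ty S)
    (i : ℕ) : SC (HOmp.liftSub T v U i) (HOmp.liftSub T v' U i) := by
  simp only [liftSub_eq_cons]
  exact rel_cons (R := fun _ => SC) (.refl _) (fun U i => (h U i).rename _ _) U i

theorem SC.subst_congr {T : Ty S} (P : Tm ob T) {v v' : Env (Tm ob)}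
    (h : ∀ U i, SC (v U i) (v' U i)) (w : Env (@Nm S)) :
    SC (P.subst v w) (P.subst v' w) := by
  induction P generalizing v v' w with
  | nil => exact .refl _
  | var i => exact h _ i
  | inp m P ih => exact .inp _ (ih (SC.liftSub h _) _)
  | out m Q ih => exact .out _ (ih h _)
  | par P Q ihP ihQ => exact .par (ihP h _) (ihQ h _)
  | pabs P ih => exact .pabs (ih (SC.liftSub h _) _)
  | papp F A ihF ihA => exact .papp (ihF h _) (ihA h _)
  | nabs P ih => exact .nabs (ih (fun U i => (h U i).rename _ _) _)
  | napp F n ih => exact .napp _ (ih h _)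

end SubstitutionLemmas

/-! ### Normal forms -/

section NormalForms

variable {S : Type u} {ob : S → Ty S}

/-- Structural congruence as a setoid. -/
def scSetoid (ob : S → Ty S) (T : Ty S) : Setoid (Tm ob T) where
  r := SC
  iseqv := ⟨.refl, .symm, .trans⟩

/-- Terms modulo structural congruence. -/
def TmClass (ob : S → Ty S) (T : Ty S) : Type u := Quotient (scSetoid ob T)

/-- The class of a term modulo structural congruence. -/
def Tm.mk {T : Ty S} (P : Tm ob T) : TmClass ob T := Quotient.mk _ P

/-- A representative of a class of terms modulo structural congruence. -/
noncomputable def TmClass.out {T : Ty S} (a : TmClass ob T) : Tm ob T := Quotient.out a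

theorem TmClass.mk_out {T : Ty S} (a : TmClass ob T) : a.out.mk = a := Quotient.out_eq a

theorem Tm.mk_eq_mk {T : Ty S} {P Q : Tm ob T} : P.mk = Q.mk ↔ SC P Q := Quotient.eq

theorem Tm.out_mk {T : Ty S} (P : Tm ob T) : SC P.mk.out P := Tm.mk_eq_mk.1 P.mk.mk_out

instance : Add (TmClass ob .proc) := ⟨Quotient.map₂ Tm.par fun _ _ hP _ _ hQ => SC.par hP hQ⟩

instance : Zero (TmClass ob .proc) := ⟨Tm.nil.mk⟩

instance : AddCommMonoid (TmClass ob .proc) where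
  add_assoc := by
    rintro ⟨P⟩ ⟨Q⟩ ⟨R⟩
    exact Quotient.sound (SC.par_assoc P Q R)
  zero_add := by
    rintro ⟨P⟩
    exact Quotient.sound ((SC.par_comm .nil P).trans (SC.par_nil P))
  add_zero := by
    rintro ⟨P⟩
    exact Quotient.sound (SC.par_nil P)
  add_comm := by
    rintro ⟨P⟩ ⟨Q⟩
    exact Quotient.sound (SC.par_comm P Q)
  nsmul := nsmulRec

/-- The components of processes in normal form: prefixes, outputs, and variables that stand alone
or are applied.  Their subterms are taken from the family `K`, which is `Tm ob` for components of
processes and `TmClass ob` for components of normal forms. -/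
inductive Component (ob : S → Ty S) (K : Ty S → Type u) : Type u
  | inp {s : S} (m : Nm s) (P : K .proc) : Component ob K
  | out {s : S} (m : Nm s) (A : K (ob s)) : Component ob K
  | var (i : ℕ) : Component ob K
  | papp {T : Ty S} (i : ℕ) (A : K T) : Component ob K
  | napp {s : S} (i : ℕ) (n : Nm s) : Component ob K

namespace Component

/-- The process that consists of a single component. -/
def toTm : Component ob (Tm ob) → Proc ob
  | .inp m P => .inp m P
  | .out m A => .out m A
  | .var i => .var i
  | .papp i A => .papp (.var i) A
  | .napp i n => .napp (.var i) n

/-- The class of a component modulo structural congruence of its subterm. -/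
def mk : Component ob (Tm ob) → Component ob (TmClass ob)
  | .inp m P => .inp m P.mk
  | .out m A => .out m A.mk
  | .var i => .var i
  | .papp i A => .papp i A.mk
  | .napp i n => .napp i n

theorem mk_surjective : Function.Surjective (mk (ob := ob)) := by
  intro c
  cases c with
  | inp m a => exact ⟨.inp m a.out, congrArg _ a.mk_out⟩
  | out m a => exact ⟨.out m a.out, congrArg _ a.mk_out⟩
  | var i => exact ⟨.var i, rfl⟩
  | papp i a => exact ⟨.papp i a.out, congrArg _ a.mk_out⟩
  | napp i n => exact ⟨.napp i n, rfl⟩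

/-- The process class that consists of a single component class. -/
def toTmClass : Component ob (TmClass ob) → TmClass ob .proc
  | .inp m a => Quotient.map (Tm.inp m) (fun _ _ h => SC.inp m h) a
  | .out m a => Quotient.map (Tm.out m) (fun _ _ h => SC.out m h) a
  | .var i => (Tm.var i).mk
  | .papp i a => Quotient.map (Tm.papp (.var i)) (fun _ _ h => SC.papp (.refl _) h) a
  | .napp i n => (Tm.napp (.var i) n).mk

/-- Renaming of the variables of a component. -/
noncomputable def rename (p : Ren (Ty S)) (r : Ren S) :
    Component ob (Tm ob) → Component ob (Tm ob)
  | .inp (s := s) m P => .inp (m.rename r) (P.rename (p.lift (ob s)) r)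
  | .out m A => .out (m.rename r) (A.rename p r)
  | .var i => .var (p .proc i)
  | .papp (T := T) i A => .papp (p (.pabs T) i) (A.rename p r)
  | .napp (s := s) i n => .napp (p (.nabs s) i) (n.rename r)

theorem rename_toTm (p : Ren (Ty S)) (r : Ren S) (c : Component ob (Tm ob)) :
    c.toTm.rename p r = (c.rename p r).toTm := by
  cases c <;> rfl

end Component

/-- Normal forms of processes: finite multisets of components. -/
abbrev NormalForm (ob : S → Ty S) : Type u := Multiset (Component ob (TmClass ob))

/-- The process class denoted by a normal form. -/
def readback (μ : NormalForm ob) : TmClass ob .proc := (μ.map Component.toTmClass).sum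

theorem readback_add (μ ν : NormalForm ob) : readback (μ + ν) = readback μ + readback ν := by
  simp only [readback, Multiset.map_add, Multiset.sum_add]

theorem readback_singleton (c : Component ob (TmClass ob)) : readback {c} = c.toTmClass := by
  simp only [readback, Multiset.map_singleton, Multiset.sum_singleton]

/-- The model in which processes denote normal forms.  An abstraction of processes takes the class
of its argument in addition to the value of the argument, because the subterms of components are
syntactic. -/
abbrev Sem (ob : S → Ty S) : Ty S → Type u
  | .proc => NormalForm ob
  | .pabs T => TmClass ob T → Sem ob T → NormalForm ob
  | .nabs s => Nm s → NormalForm ob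

/-- The value of a term in the model: `v` and `w` are the syntactic values of the variables, `e`
the semantic values of the process variables. -/
noncomputable def Tm.eval :
    {T : Ty S} → Tm ob T → Env (Tm ob) → Env (@Nm S) → Env (Sem ob) → Sem ob T
  | _, .nil, _, _, _ => 0
  | T, .var i, _, _, e => e T i
  | _, .inp (s := s) m P, v, w, _ =>
      {.inp (m.subst w) (P.subst (liftSub (ob s) v) w).mk}
  | _, .out m A, v, w, _ => {.out (m.subst w) (A.subst v w).mk}
  | _, .par P Q, v, w, e => P.eval v w e + Q.eval v w e
  | _, .pabs (T := T) P, v, w, e => fun A a => P.eval (cons T A.out v) w (cons T a e)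
  | _, .papp F A, v, w, e => F.eval v w e (A.subst v w).mk (A.eval v w e)
  | _, .nabs (s := s) P, v, w, e => fun n => P.eval v (cons s n w) e
  | _, .napp F n, v, w, e => F.eval v w e (n.subst w)

theorem Tm.eval_rename {T : Ty S} (P : Tm ob T) (p : Ren (Ty S)) (r : Ren S) (v : Env (Tm ob))
    (w : Env (@Nm S)) (e : Env (Sem ob)) :
    (P.rename p r).eval v w e =
      P.eval (fun U i => v U (p U i)) (fun t i => w t (r t i)) (fun U i => e U (p U i)) := by
  induction P generalizing p r v w e with
  | nil => rfl
  | var i => rfl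
  | inp m P _ => simp only [rename, eval, subst_rename, Nm.subst_rename, liftSub_lift]
  | out m Q _ => simp only [rename, eval, subst_rename, Nm.subst_rename]
  | par P Q ihP ihQ => simp only [rename, eval, ihP, ihQ]
  | pabs P ih => simp only [rename, eval, ih, cons_lift]
  | papp F A ihF ihA => simp only [rename, eval, ihF, ihA, subst_rename]
  | nabs P ih => simp only [rename, eval, ih, cons_lift]
  | napp F n ih => simp only [rename, eval, ih, Nm.subst_rename]

theorem eval_liftSub_cons {T : Ty S} (v' : Env (Tm ob)) (A : Tm ob T) (a : Sem ob T)
    (v : Env (Tm ob)) (w : Env (@Nm S)) (e : Env (Sem ob)) :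
    (fun U i => (liftSub T v' U i).eval (cons T A v) w (cons T a e)) =
      cons T a fun U i => (v' U i).eval v w e := by
  rw [liftSub_eq_cons, map_cons fun U (Q : Tm ob U) => Q.eval (cons T A v) w (cons T a e)]
  simp only [Tm.weaken, Tm.eval_rename, cons_shift, Ren.id]
  simp only [Tm.eval, cons_zero]

theorem Tm.eval_nweaken_cons {s : S} {T : Ty S} (P : Tm ob T) (n : Nm s) (v : Env (Tm ob))
    (w : Env (@Nm S)) (e : Env (Sem ob)) :
    (P.nweaken s).eval v (cons s n w) e = P.eval v w e := by
  simp only [nweaken, eval_rename, cons_shift, Ren.id]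

theorem Tm.eval_subst {T : Ty S} (P : Tm ob T) (v' : Env (Tm ob)) (w' : Env (@Nm S))
    (v : Env (Tm ob)) (w : Env (@Nm S)) (e : Env (Sem ob)) :
    (P.subst v' w').eval v w e =
      P.eval (fun U i => (v' U i).subst v w) (fun t i => (w' t i).subst w)
        (fun U i => (v' U i).eval v w e) := by
  induction P generalizing v' w' v w e with
  | nil => rfl
  | var i => rfl
  | inp m P _ => simp only [subst, eval, subst_subst, subst_liftSub, Nm.subst_subst]
  | out m Q _ => simp only [subst, eval, subst_subst, Nm.subst_subst]
  | par P Q ihP ihQ => simp only [subst, eval, ihP, ihQ]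
  | pabs P ih => simp only [subst, eval, ih, subst_liftSub_cons, eval_liftSub_cons]
  | papp F A ihF ihA => simp only [subst, eval, ihF, ihA, subst_subst]
  | nabs P ih =>
    simp only [subst, eval, ih, subst_liftNSub_cons, subst_nweaken_cons, eval_nweaken_cons]
  | napp F n ih => simp only [subst, eval, ih, Nm.subst_subst]

theorem Tm.eval_congr {T : Ty S} (P : Tm ob T) {v v' : Env (Tm ob)}
    (h : ∀ U i, SC (v U i) (v' U i)) (w : Env (@Nm S)) (e : Env (Sem ob)) :
    P.eval v w e = P.eval v' w e := by
  induction P generalizing v v' w e with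
  | nil => rfl
  | var i => rfl
  | inp m P _ => simp only [eval, mk_eq_mk.2 (SC.subst_congr P (SC.liftSub h _) w)]
  | out m A _ => simp only [eval, mk_eq_mk.2 (SC.subst_congr A h w)]
  | par P Q ihP ihQ => simp only [eval, ihP h, ihQ h]
  | pabs P ih =>
    funext A a
    exact ih (rel_cons (R := fun _ => SC) (.refl _) h) _ _
  | papp F A ihF ihA => simp only [eval, ihF h, ihA h, mk_eq_mk.2 (SC.subst_congr A h w)]
  | nabs P ih => simp only [eval, ih h]
  | napp F n ih => simp only [eval, ih h]

theorem Tm.eval_cons_out_mk {T U : Ty S} (P : Tm ob U) (A : Tm ob T) (a : Sem ob T)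
    (v : Env (Tm ob)) (w : Env (@Nm S)) (e : Env (Sem ob)) :
    P.eval (cons T A.mk.out v) w (cons T a e) = P.eval (cons T A v) w (cons T a e) :=
  P.eval_congr (rel_cons (R := fun _ => SC) A.out_mk fun _ _ => .refl _) _ _

theorem Tm.eval_inst {T U : Ty S} (P : Tm ob U) (A : Tm ob T) (v : Env (Tm ob))
    (w : Env (@Nm S)) (e : Env (Sem ob)) :
    (P.inst A).eval v w e = P.eval (cons T (A.subst v w) v) w (cons T (A.eval v w e) e) := by
  rw [inst_eq, eval_subst, map_cons fun U (Q : Tm ob U) => Q.subst v w,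
    map_cons fun U (Q : Tm ob U) => Q.eval v w e]
  rfl

theorem Tm.eval_ninst {s : S} {U : Ty S} (P : Tm ob U) (n : Nm s) (v : Env (Tm ob))
    (w : Env (@Nm S)) (e : Env (Sem ob)) :
    (P.ninst n).eval v w e = P.eval v (cons s (n.subst w) w) e := by
  rw [ninst_eq, eval_subst, map_cons fun t (m : Nm t) => m.subst w]
  rfl

theorem SC.eval_eq {T : Ty S} {P Q : Tm ob T} (h : SC P Q) (v : Env (Tm ob)) (w : Env (@Nm S))
    (e : Env (Sem ob)) : P.eval v w e = Q.eval v w e := by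
  induction h generalizing v w e with
  | refl P => rfl
  | symm _ ih => exact (ih v w e).symm
  | trans _ _ ih₁ ih₂ => exact (ih₁ v w e).trans (ih₂ v w e)
  | inp m h _ => simp only [Tm.eval, Tm.mk_eq_mk.2 (h.subst _ _)]
  | out m h _ => simp only [Tm.eval, Tm.mk_eq_mk.2 (h.subst _ _)]
  | par _ _ ih₁ ih₂ => simp only [Tm.eval, ih₁, ih₂]
  | pabs _ ih => simp only [Tm.eval, ih]
  | papp _ h ih₁ ih₂ => simp only [Tm.eval, ih₁, ih₂, Tm.mk_eq_mk.2 (h.subst _ _)]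
  | nabs _ ih => simp only [Tm.eval, ih]
  | napp n _ ih => simp only [Tm.eval, ih]
  | par_assoc P Q R => exact add_assoc _ _ _
  | par_comm P Q => exact add_comm _ _
  | par_nil P => exact add_zero _
  | papp_pabs P A => rw [Tm.eval_inst, ← Tm.eval_cons_out_mk]; rfl
  | napp_nabs P n => exact (P.eval_ninst n v w e).symm

/-- The logical relation between terms and their values: a process is read back from its value, and
related arguments have related applications. -/
def ReadsBack : {T : Ty S} → Tm ob T → Sem ob T → Prop
  | .proc, P, μ => P.mk = readback μ
  | .pabs _, F, f => ∀ A a, ReadsBack A a → (Tm.papp F A).mk = readback (f A.mk a)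
  | .nabs _, F, f => ∀ n, (Tm.napp F n).mk = readback (f n)

/-- The value of the free variable `i` of type `T`. -/
def reflect : (T : Ty S) → ℕ → Sem ob T
  | .proc, i => {.var i}
  | .pabs _, i => fun A _ => {.papp i A}
  | .nabs _, i => fun n => {.napp i n}

theorem readsBack_var (T : Ty S) (i : ℕ) : ReadsBack (Tm.var i : Tm ob T) (reflect T i) := by
  cases T with
  | proc => exact (readback_singleton (.var i)).symm
  | pabs T => exact fun A _ _ => (readback_singleton (.papp i A.mk)).symm
  | nabs s => exact fun n => (readback_singleton (.napp i n)).symm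

theorem Tm.readsBack_eval {T : Ty S} (P : Tm ob T) {v : Env (Tm ob)} (w : Env (@Nm S))
    {e : Env (Sem ob)} (h : ∀ U i, ReadsBack (v U i) (e U i)) :
    ReadsBack (P.subst v w) (P.eval v w e) := by
  induction P generalizing v w e with
  | nil => rfl
  | var i => exact h _ i
  | inp m P _ => exact (readback_singleton (.inp _ (Tm.mk _))).symm
  | out m Q _ => exact (readback_singleton (.out _ (Tm.mk _))).symm
  | par P Q ihP ihQ =>
    exact (congrArg₂ (· + ·) (ihP w h) (ihQ w h)).trans (readback_add _ _).symm
  | @pabs T P ih =>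
    intro A a hA
    have hbody := ih w (rel_cons (R := fun _ => ReadsBack) hA h)
    rw [← inst_subst_liftSub, ← eval_cons_out_mk] at hbody
    exact (mk_eq_mk.2 (.papp_pabs _ _)).trans hbody
  | papp _ A ihF ihA => exact ihF w h _ _ (ihA w h)
  | @nabs s P ih =>
    intro n
    have hbody := ih (cons s n w) h
    rw [← ninst_subst_liftNSub] at hbody
    exact (mk_eq_mk.2 (.napp_nabs _ _)).trans hbody
  | napp _ n ih => exact ih w h _

/-- The normal form of a process. -/
noncomputable def Tm.nf (P : Proc ob) : NormalForm ob :=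
  P.eval (fun _ i => .var i) (fun _ i => .var i) reflect

theorem Tm.mk_eq_readback_nf (P : Proc ob) : P.mk = readback P.nf := by
  conv_lhs => rw [← P.subst_id]
  exact P.readsBack_eval _ readsBack_var

theorem Tm.sc_iff_nf_eq {P Q : Proc ob} : SC P Q ↔ P.nf = Q.nf :=
  ⟨fun h => h.eval_eq _ _ _, fun h =>
    mk_eq_mk.1 (by rw [mk_eq_readback_nf, h, ← mk_eq_readback_nf])⟩

theorem Tm.nf_nil : (Tm.nil : Proc ob).nf = 0 := rfl

theorem Tm.nf_par (P Q : Proc ob) : (Tm.par P Q).nf = P.nf + Q.nf := rfl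

theorem liftSub_id (T : Ty S) :
    liftSub T (fun _ i => .var i) = fun U i => (.var i : Tm ob U) :=
  (liftSub_var T Ren.id).trans (by rw [Ren.lift_id]; rfl)

theorem Component.nf_toTm (c : Component ob (Tm ob)) : c.toTm.nf = {c.mk} := by
  cases c <;>
    simp only [toTm, mk, Tm.nf, Tm.eval, reflect, liftSub_id, Tm.subst_id, Nm.subst_id]

theorem Component.nf_toTm_par (c : Component ob (Tm ob)) (P : Proc ob) :
    (Tm.par c.toTm P).nf = c.mk ::ₘ P.nf := by
  rw [Tm.nf_par, c.nf_toTm, Multiset.singleton_add]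

theorem Component.sc_toTm_iff {c d : Component ob (Tm ob)} : SC c.toTm d.toTm ↔ c.mk = d.mk := by
  rw [Tm.sc_iff_nf_eq, nf_toTm, nf_toTm, Multiset.singleton_inj]

theorem sc_par_iff {P R : Proc ob} {c : Component ob (Tm ob)} :
    SC P (.par c.toTm R) ↔ P.nf = c.mk ::ₘ R.nf := by
  rw [Tm.sc_iff_nf_eq, c.nf_toTm_par]

theorem Tm.nf_surjective : Function.Surjective (Tm.nf (ob := ob)) := by
  intro μ
  induction μ using Multiset.induction_on with
  | empty => exact ⟨.nil, nf_nil⟩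
  | cons c μ ih =>
    obtain ⟨P, rfl⟩ := ih
    obtain ⟨c, rfl⟩ := c.mk_surjective
    exact ⟨.par c.toTm P, c.nf_toTm_par P⟩

theorem mk_mem_nf_iff {P : Proc ob} {c : Component ob (Tm ob)} :
    c.mk ∈ P.nf ↔ ∃ R, SC P (.par c.toTm R) := by
  refine ⟨fun hc => ?_, fun ⟨R, hR⟩ => sc_par_iff.1 hR ▸ Multiset.mem_cons_self _ _⟩
  obtain ⟨μ, hμ⟩ := Multiset.exists_cons_of_mem hc
  obtain ⟨R, rfl⟩ := Tm.nf_surjective μ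
  exact ⟨R, sc_par_iff.2 hμ⟩

theorem SC.par_cancel_left {c : Component ob (Tm ob)} {P Q : Proc ob}
    (h : SC (.par c.toTm P) (.par c.toTm Q)) : SC P Q := by
  rwa [Tm.sc_iff_nf_eq, c.nf_toTm_par, c.nf_toTm_par, Multiset.cons_inj_right,
    ← Tm.sc_iff_nf_eq] at h

theorem SC.pull_left {P P' A : Proc ob} (h : SC P (.par A P')) (Q : Proc ob) :
    SC (.par P Q) (.par A (.par P' Q)) :=
  (h.par (.refl Q)).trans (.par_assoc A P' Q)

theorem SC.pull_right {Q Q' A : Proc ob} (h : SC Q (.par A Q')) (P : Proc ob) :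
    SC (.par P Q) (.par A (.par P Q')) :=
  (SC.par_comm P Q).trans ((h.pull_left P).trans (.par (.refl A) (.par_comm Q' P)))

theorem SC.par_split {P Q R : Proc ob} {c : Component ob (Tm ob)}
    (h : SC (.par P Q) (.par c.toTm R)) :
    (∃ P', SC P (.par c.toTm P') ∧ SC R (.par P' Q)) ∨
      (∃ Q', SC Q (.par c.toTm Q') ∧ SC R (.par P Q')) := by
  rcases Multiset.mem_add.1 (mk_mem_nf_iff.2 ⟨R, h⟩ : c.mk ∈ P.nf + Q.nf) with hc | hc
  · obtain ⟨P', hP'⟩ := mk_mem_nf_iff.1 hc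
    exact .inl ⟨P', hP', SC.par_cancel_left (h.symm.trans (hP'.pull_left Q))⟩
  · obtain ⟨Q', hQ'⟩ := mk_mem_nf_iff.1 hc
    exact .inr ⟨Q', hQ', SC.par_cancel_left (h.symm.trans (hQ'.pull_right P))⟩

theorem not_sc_nil_par {R : Proc ob} {c : Component ob (Tm ob)} : ¬ SC .nil (.par c.toTm R) := by
  rw [sc_par_iff, Tm.nf_nil]
  exact Multiset.cons_ne_zero.symm

theorem Tm.component_induction {motive : Proc ob → Prop} (nil : motive .nil)
    (par : ∀ (c : Component ob (Tm ob)) (P : Proc ob), motive P → motive (.par c.toTm P))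
    (sc : ∀ P Q : Proc ob, SC P Q → motive P → motive Q) (P : Proc ob) : motive P := by
  suffices ∀ (μ : NormalForm ob) (P : Proc ob), P.nf = μ → motive P from this _ P rfl
  intro μ
  induction μ using Multiset.induction_on with
  | empty => exact fun P hP => sc _ _ (sc_iff_nf_eq.2 (nf_nil.trans hP.symm)) nil
  | cons c μ ih =>
    intro P hP
    obtain ⟨c, rfl⟩ := c.mk_surjective
    obtain ⟨Q, rfl⟩ := nf_surjective μ
    exact sc _ _ (sc_par_iff.2 hP).symm (par c Q (ih Q rfl))

theorem Tm.sc_nil_or_component (P : Proc ob) :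
    SC P .nil ∨ ∃ (c : Component ob (Tm ob)) (R : Proc ob), SC P (.par c.toTm R) := by
  induction P using Tm.component_induction with
  | nil => exact .inl (.refl _)
  | par c P _ => exact .inr ⟨c, P, .refl _⟩
  | sc P Q h ih => exact ih.imp h.symm.trans fun ⟨c, R, hR⟩ => ⟨c, R, h.symm.trans hR⟩

theorem Tm.exists_of_mem_nf_rename (p : Ren (Ty S)) (r : Ren S) (P : Proc ob) :
    ∀ c ∈ (P.rename p r).nf, ∃ d : Component ob (Tm ob), d.mk ∈ P.nf ∧ (d.rename p r).mk = c := by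
  induction P using Tm.component_induction with
  | nil => simp [rename, nf_nil]
  | par k P ih =>
    intro c hc
    rw [rename, k.rename_toTm, Component.nf_toTm_par, Multiset.mem_cons] at hc
    rw [k.nf_toTm_par]
    rcases hc with rfl | hc
    · exact ⟨k, Multiset.mem_cons_self _ _, rfl⟩
    · obtain ⟨d, hd, rfl⟩ := ih c hc
      exact ⟨d, Multiset.mem_cons_of_mem hd, rfl⟩
  | sc P Q h ih => rwa [← sc_iff_nf_eq.1 h, ← sc_iff_nf_eq.1 (h.rename p r)]

theorem SC.exists_of_rename {p : Ren (Ty S)} {r : Ren S} {P R : Proc ob}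
    {c : Component ob (Tm ob)} (h : SC (P.rename p r) (.par c.toTm R)) :
    ∃ (d : Component ob (Tm ob)) (Q : Proc ob),
      SC P (.par d.toTm Q) ∧ (d.rename p r).mk = c.mk ∧ SC R (Q.rename p r) := by
  obtain ⟨d, hd, hdc⟩ := P.exists_of_mem_nf_rename p r c.mk (mk_mem_nf_iff.2 ⟨R, h⟩)
  obtain ⟨Q, hQ⟩ := mk_mem_nf_iff.1 hd
  refine ⟨d, Q, hQ, hdc, SC.par_cancel_left (h.symm.trans ((hQ.rename p r).trans ?_))⟩
  rw [Tm.rename, d.rename_toTm]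
  exact .par (Component.sc_toTm_iff.2 hdc) (.refl _)

/-- The shape of structurally congruent terms of abstraction type. -/
inductive AbsSC : {T : Ty S} → Tm ob T → Tm ob T → Prop
  | proc (P Q : Proc ob) : AbsSC P Q
  | pabs {T : Ty S} {P Q : Proc ob} : SC P Q → AbsSC (.pabs (T := T) P) (.pabs Q)
  | nabs {s : S} {P Q : Proc ob} : SC P Q → AbsSC (.nabs (s := s) P) (.nabs Q)
  | var {T : Ty S} (i : ℕ) : AbsSC (.var i : Tm ob T) (.var i)

theorem SC.absSC {T : Ty S} {P Q : Tm ob T} (h : SC P Q) : AbsSC P Q := by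
  induction h with
  | @refl T P =>
    cases P with
    | pabs P => exact .pabs (.refl P)
    | nabs P => exact .nabs (.refl P)
    | var i => exact .var i
    | _ => exact .proc _ _
  | symm _ ih =>
    cases ih with
    | proc P Q => exact .proc _ _
    | pabs h => exact .pabs h.symm
    | nabs h => exact .nabs h.symm
    | var i => exact .var i
  | trans _ _ ih₁ ih₂ =>
    cases ih₁ with
    | proc P Q => exact .proc _ _
    | pabs h => cases ih₂ with | pabs h' => exact .pabs (h.trans h')
    | nabs h => cases ih₂ with | nabs h' => exact .nabs (h.trans h')
    | var i => exact ih₂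
  | pabs h _ => exact .pabs h
  | nabs h _ => exact .nabs h
  | _ => exact .proc _ _

theorem SC.pabs_left {T : Ty S} {A : Proc ob} {Q : Tm ob (.pabs T)} (h : SC (.pabs A) Q) :
    ∃ B, Q = .pabs B ∧ SC A B := by
  cases h.absSC with
  | pabs h' => exact ⟨_, rfl, h'⟩

theorem SC.nabs_left {s : S} {A : Proc ob} {Q : Tm ob (.nabs s)} (h : SC (.nabs A) Q) :
    ∃ B, Q = .nabs B ∧ SC A B := by
  cases h.absSC with
  | nabs h' => exact ⟨_, rfl, h'⟩

theorem SC.var_left {T : Ty S} (hT : T ≠ .proc) {i : ℕ} {Q : Tm ob T} (h : SC (.var i) Q) :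
    Q = .var i := by
  cases h.absSC with
  | proc => exact absurd rfl hT
  | var => rfl

theorem SC.isAbs_iff {T : Ty S} {P Q : Tm ob T} (h : SC P Q) : P.IsAbs ↔ Q.IsAbs := by
  cases h.absSC with
  | proc P Q => cases P <;> cases Q <;> simp [Tm.IsAbs]
  | pabs => simp [Tm.IsAbs]
  | nabs => simp [Tm.IsAbs]
  | var => rfl

end NormalForms

/-! ### Sizes -/

section Size

variable {S : Type u} {ob : S → Ty S}

/-- The model in which processes denote the sizes of their normal forms. -/
abbrev SizeSem : Ty S → Type
  | .proc => ℕ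
  | .pabs T => SizeSem T → ℕ
  | .nabs _ => ℕ

mutual

/-- The denotation of a free variable in the size model. -/
def sizeReflect : (T : Ty S) → SizeSem T
  | .proc => 1
  | .pabs T => fun a => sizeReify T a + 1
  | .nabs _ => 1

/-- The size of the terms with a given denotation in the size model. -/
def sizeReify : (T : Ty S) → SizeSem T → ℕ
  | .proc, n => n
  | .pabs T, f => f (sizeReflect T) + 1
  | .nabs _, n => n + 1

end

/-- The interpretation of terms in the size model. -/
noncomputable def Tm.sizeEval : {T : Ty S} → Tm ob T → Env (SizeSem (S := S)) → SizeSem T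
  | _, .nil, _ => 0
  | T, .var i, e => e T i
  | _, .inp (s := s) _ P, e => P.sizeEval (cons (ob s) (sizeReflect _) e) + 1
  | _, .out _ A, e => sizeReify _ (A.sizeEval e) + 1
  | _, .par P Q, e => P.sizeEval e + Q.sizeEval e
  | _, .pabs (T := T) P, e => fun b => P.sizeEval (cons T b e)
  | _, .papp F A, e => F.sizeEval e (A.sizeEval e)
  | _, .nabs P, e => P.sizeEval e
  | _, .napp F _, e => F.sizeEval e

theorem Tm.sizeEval_rename {T : Ty S} (P : Tm ob T) (p : Ren (Ty S)) (r : Ren S)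
    (e : Env (SizeSem (S := S))) :
    (P.rename p r).sizeEval e = P.sizeEval (fun U i => e U (p U i)) := by
  induction P generalizing p r e with
  | nil => rfl
  | var i => rfl
  | inp m P ih => simp only [rename, sizeEval, ih, cons_lift]
  | out m Q ih => simp only [rename, sizeEval, ih]
  | par P Q ihP ihQ => simp only [rename, sizeEval, ihP, ihQ]
  | pabs P ih => simp only [rename, sizeEval, ih, cons_lift]
  | papp F A ihF ihA => simp only [rename, sizeEval, ihF, ihA]
  | nabs P ih => simp only [rename, sizeEval, ih]
  | napp F n ih => simp only [rename, sizeEval, ih]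

theorem sizeEval_liftSub_cons {T : Ty S} (v : Env (Tm ob)) (b : SizeSem T)
    (e : Env (SizeSem (S := S))) :
    (fun U i => (liftSub T v U i).sizeEval (cons T b e)) =
      cons T b fun U i => (v U i).sizeEval e := by
  rw [liftSub_eq_cons, map_cons fun U (Q : Tm ob U) => Q.sizeEval (cons T b e)]
  simp only [Tm.weaken, Tm.sizeEval_rename, cons_shift]
  simp only [Tm.sizeEval, cons_zero]

theorem Tm.sizeEval_subst {T : Ty S} (P : Tm ob T) (v : Env (Tm ob)) (w : Env (@Nm S))
    (e : Env (SizeSem (S := S))) :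
    (P.subst v w).sizeEval e = P.sizeEval (fun U i => (v U i).sizeEval e) := by
  induction P generalizing v w e with
  | nil => rfl
  | var i => rfl
  | inp m P ih => simp only [subst, sizeEval, ih, sizeEval_liftSub_cons]
  | out m Q ih => simp only [subst, sizeEval, ih]
  | par P Q ihP ihQ => simp only [subst, sizeEval, ihP, ihQ]
  | pabs P ih => simp only [subst, sizeEval, ih, sizeEval_liftSub_cons]
  | papp F A ihF ihA => simp only [subst, sizeEval, ihF, ihA]
  | nabs P ih => simp only [subst, sizeEval, ih, nweaken, sizeEval_rename, Ren.id]
  | napp F n ih => simp only [subst, sizeEval, ih]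

theorem Tm.sizeEval_inst {T U : Ty S} (P : Tm ob U) (A : Tm ob T) (e : Env (SizeSem (S := S))) :
    (P.inst A).sizeEval e = P.sizeEval (cons T (A.sizeEval e) e) := by
  rw [inst_eq, sizeEval_subst, map_cons fun U (Q : Tm ob U) => Q.sizeEval e]
  rfl

theorem Tm.sizeEval_ninst {s : S} {U : Ty S} (P : Tm ob U) (n : Nm s)
    (e : Env (SizeSem (S := S))) : (P.ninst n).sizeEval e = P.sizeEval e := by
  rw [ninst_eq, sizeEval_subst]
  rfl

theorem SC.sizeEval_eq {T : Ty S} {P Q : Tm ob T} (h : SC P Q) (e : Env (SizeSem (S := S))) :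
    P.sizeEval e = Q.sizeEval e := by
  induction h generalizing e with
  | refl P => rfl
  | symm _ ih => exact (ih e).symm
  | trans _ _ ih₁ ih₂ => exact (ih₁ e).trans (ih₂ e)
  | inp m _ ih => simp only [Tm.sizeEval, ih]
  | out m _ ih => simp only [Tm.sizeEval, ih]
  | par _ _ ih₁ ih₂ => simp only [Tm.sizeEval, ih₁, ih₂]
  | pabs _ ih => simp only [Tm.sizeEval, ih]
  | papp _ _ ih₁ ih₂ => simp only [Tm.sizeEval, ih₁, ih₂]
  | nabs _ ih => simp only [Tm.sizeEval, ih]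
  | napp n _ ih => simp only [Tm.sizeEval, ih]
  | par_assoc P Q R => exact add_assoc _ _ _
  | par_comm P Q => exact add_comm _ _
  | par_nil P => exact add_zero _
  | papp_pabs P A => exact (P.sizeEval_inst A e).symm
  | napp_nabs P n => exact (P.sizeEval_ninst n e).symm

/-- The size of the normal form of a term. -/
noncomputable def Tm.size {T : Ty S} (P : Tm ob T) : ℕ :=
  sizeReify T (P.sizeEval fun U _ => sizeReflect U)

theorem SC.size_eq {T : Ty S} {P Q : Tm ob T} (h : SC P Q) : P.size = Q.size :=
  congrArg (sizeReify T) (h.sizeEval_eq _)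

theorem Tm.size_rename {T : Ty S} (P : Tm ob T) (p : Ren (Ty S)) (r : Ren S) :
    (P.rename p r).size = P.size := by
  simp only [size, sizeEval_rename]

theorem cons_sizeReflect (T : Ty S) :
    cons T (sizeReflect T) (fun U _ => sizeReflect U) = fun U _ => sizeReflect U :=
  cons_self_shift T fun U _ => sizeReflect U

theorem Tm.size_nil : (Tm.nil : Proc ob).size = 0 := by
  simp only [size, sizeEval, sizeReify]

theorem Tm.size_par (P Q : Proc ob) : (Tm.par P Q).size = P.size + Q.size := by
  simp only [size, sizeEval, sizeReify]

theorem Tm.size_pabs {T : Ty S} (P : Proc ob) : (Tm.pabs (T := T) P).size = P.size + 1 := by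
  simp only [size, sizeEval, sizeReify, cons_sizeReflect]

theorem Tm.size_nabs {s : S} (P : Proc ob) : (Tm.nabs (s := s) P).size = P.size + 1 := by
  simp only [size, sizeEval, sizeReify]

/-- The size of a component. -/
noncomputable def Component.size : Component ob (Tm ob) → ℕ
  | .inp _ P => P.size + 1
  | .out _ A => A.size + 1
  | .var _ => 1
  | .papp _ A => A.size + 1
  | .napp _ _ => 1

theorem Component.size_toTm (c : Component ob (Tm ob)) : c.toTm.size = c.size := by
  cases c <;>
    simp only [toTm, size, Tm.size, Tm.sizeEval, sizeReify, sizeReflect, cons_sizeReflect]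

end Size

/-! ### Bisimilarity as a congruence -/

section Bisimilarity

variable {S : Type u} {ob : S → Ty S}

/-- Families of relations between terms of the same type. -/
abbrev TermRel (ob : S → Ty S) : Type u := ∀ ⦃T : Ty S⦄, Tm ob T → Tm ob T → Prop

namespace Component

/-- What a process becomes when a component in parallel to it is consumed. -/
noncomputable def frame : Component ob (Tm ob) → Proc ob → Proc ob
  | .inp (s := s) _ _, R => R.weaken (ob s)
  | _, R => R

/-- What remains of `c | R` after the component `c` has been consumed. -/
noncomputable def residual : Component ob (Tm ob) → Proc ob → Proc ob
  | .inp (s := s) _ A, R => .par A (R.weaken (ob s))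
  | _, R => R

/-- The renaming of the residuals of a component that a renaming of the component induces: it is
lifted when the component is an input, whose variable is free in the residual. -/
noncomputable def liftRen : Component ob (Tm ob) → Ren (Ty S) → Ren (Ty S)
  | .inp (s := s) _ _, p => p.lift (ob s)
  | _, p => p

/-- Components that give rise to the same observation, up to the relation `R` between the terms
that are observed.  The body of an input is not observed; it is part of the residual. -/
inductive Match (R : TermRel ob) : Component ob (Tm ob) → Component ob (Tm ob) → Prop
  | inp {s : S} (m : Nm s) (A B : Proc ob) : Match R (.inp m A) (.inp m B)
  | out {s : S} (m : Nm s) {A B : Tm ob (ob s)} : R A B → Match R (.out m A) (.out m B)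
  | var (i : ℕ) : Match R (.var i) (.var i)
  | papp {T : Ty S} (i : ℕ) {A B : Tm ob T} : R A B → Match R (.papp i A) (.papp i B)
  | napp {s : S} (i : ℕ) (n : Nm s) : Match R (.napp i n) (.napp i n)

variable {R R' R'' : TermRel ob} {c d e : Component ob (Tm ob)}

theorem Match.mono_of_size_lt
    (hR : ∀ ⦃T : Ty S⦄ ⦃A B : Tm ob T⦄, A.size < c.size → R A B → R' A B)
    (h : c.Match R d) : c.Match R' d := by
  cases h with
  | inp m A B => exact .inp m A B
  | out m h => exact .out m (hR (Nat.lt_succ_self _) h)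
  | var i => exact .var i
  | papp i h => exact .papp i (hR (Nat.lt_succ_self _) h)
  | napp i n => exact .napp i n

theorem Match.mono (hR : ∀ ⦃T : Ty S⦄ ⦃A B : Tm ob T⦄, R A B → R' A B) (h : c.Match R d) :
    c.Match R' d :=
  h.mono_of_size_lt fun _ _ _ _ => @hR _ _ _

theorem Match.comp
    (hR : ∀ ⦃T : Ty S⦄ ⦃A B C : Tm ob T⦄, R A B → R' B C → R'' A C)
    (h : c.Match R d) (h' : d.Match R' e) : c.Match R'' e := by
  cases h with
  | inp m A B => cases h' with | inp => exact .inp _ _ _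
  | out m h => cases h' with | out _ h' => exact .out _ (hR h h')
  | var i => cases h' with | var => exact .var _
  | papp i h => cases h' with | papp _ h' => exact .papp _ (hR h h')
  | napp i n => cases h' with | napp => exact .napp _ _

theorem Match.refl (hR : ∀ ⦃T : Ty S⦄ (A : Tm ob T), R A A) (c : Component ob (Tm ob)) :
    c.Match R c := by
  cases c with
  | inp m A => exact .inp m A A
  | out m A => exact .out m (hR A)
  | var i => exact .var i
  | papp i A => exact .papp i (hR A)
  | napp i n => exact .napp i n

theorem Match.rename {p : Ren (Ty S)} {r : Ren S}
    (hR : ∀ ⦃T : Ty S⦄ ⦃A B : Tm ob T⦄, R A B → R' (A.rename p r) (B.rename p r))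
    (h : c.Match R d) : (c.rename p r).Match R' (d.rename p r) := by
  cases h with
  | inp m A B => exact .inp _ _ _
  | out m h => exact .out _ (hR h)
  | var i => exact .var _
  | papp i h => exact .papp _ (hR h)
  | napp i n => exact .napp _ _

theorem Match.frame_eq (h : c.Match R d) : c.frame = d.frame := by
  cases h <;> rfl

theorem Match.liftRen_eq (h : c.Match R d) : c.liftRen = d.liftRen := by
  cases h <;> rfl

theorem match_of_mk_eq (h : c.mk = d.mk) : c.Match (@SC S ob) d := by
  cases c with
  | inp m A =>
    cases d with
    | inp m' B =>
      obtain ⟨rfl, hm, -⟩ := inp.inj h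
      exact eq_of_heq hm ▸ .inp m A B
    | _ => cases h
  | out m A =>
    cases d with
    | out m' B =>
      obtain ⟨rfl, hm, hAB⟩ := out.inj h
      exact eq_of_heq hm ▸ .out m (Tm.mk_eq_mk.1 (eq_of_heq hAB))
    | _ => cases h
  | papp i A =>
    cases d with
    | papp j B =>
      obtain ⟨rfl, rfl, hAB⟩ := papp.inj h
      exact .papp i (Tm.mk_eq_mk.1 (eq_of_heq hAB))
    | _ => cases h
  | var i => cases d <;> cases h; exact .var i
  | napp i n => cases d <;> cases h; exact .napp i n

theorem residual_congr (h : c.mk = d.mk) {P Q : Proc ob} (hPQ : SC P Q) :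
    SC (c.residual P) (d.residual Q) := by
  cases match_of_mk_eq h with
  | inp m A B =>
    obtain ⟨-, -, hAB⟩ := inp.inj h
    exact .par (Tm.mk_eq_mk.1 hAB) (hPQ.rename _ _)
  | _ => exact hPQ

theorem residual_par_left (c : Component ob (Tm ob)) (P Q : Proc ob) :
    SC (c.residual (.par P Q)) (.par (c.residual P) (c.frame Q)) := by
  cases c with
  | inp m A => exact (SC.par_assoc _ _ _).symm
  | _ => exact .refl _

theorem residual_par_right (c : Component ob (Tm ob)) (P Q : Proc ob) :
    SC (c.residual (.par P Q)) (.par (c.frame P) (c.residual Q)) :=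
  (residual_congr rfl (.par_comm P Q)).trans ((c.residual_par_left Q P).trans (.par_comm _ _))

theorem residual_rename (c : Component ob (Tm ob)) (P : Proc ob) (p : Ren (Ty S)) (r : Ren S) :
    (c.rename p r).residual (P.rename p r) = (c.residual P).rename (c.liftRen p) r := by
  cases c with
  | inp m A => simp only [residual, rename, liftRen, Tm.rename, Tm.rename_weaken]
  | _ => rfl

theorem size_residual_lt (c : Component ob (Tm ob)) (P : Proc ob) :
    (c.residual P).size < c.size + P.size := by
  cases c <;> simp only [residual, size, Tm.size_par, Tm.weaken, Tm.size_rename] <;> omega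

theorem Match.size_add_eq (h : c.Match (fun _ A B => A.size = B.size) d) {P Q : Proc ob}
    (hPQ : (c.residual P).size = (d.residual Q).size) : c.size + P.size = d.size + Q.size := by
  cases h <;> simp only [residual, size, Tm.size_par, Tm.weaken, Tm.size_rename] at hPQ ⊢ <;> omega

end Component

theorem step_inp_iff {s : S} {m : Nm s} {P P' : Proc ob} :
    Step (.inp m) P P' ↔
      ∃ A P₀, SC P (.par (.inp m A) P₀) ∧ SC P' (.par A (P₀.weaken (ob s))) := by
  refine ⟨fun h => ?_, fun ⟨A, P₀, h₁, h₂⟩ => .struct h₁ (.parL P₀ (.inp m A)) h₂.symm⟩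
  generalize ha : Act.inp m = a at h
  induction h with
  | inp m P =>
    cases ha
    exact ⟨P, .nil, (SC.par_nil _).symm, (SC.par_nil _).symm⟩
  | parL Q _ ih =>
    obtain ⟨A, P₀, h₁, h₂⟩ := ih ha
    subst ha
    exact ⟨A, .par P₀ Q, h₁.pull_left Q, h₂.pull_left _⟩
  | parR Q _ ih =>
    obtain ⟨A, P₀, h₁, h₂⟩ := ih ha
    subst ha
    exact ⟨A, .par Q P₀, h₁.pull_right Q, h₂.pull_right _⟩
  | struct h₁ _ h₂ ih =>
    obtain ⟨A, P₀, h₃, h₄⟩ := ih ha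
    exact ⟨A, P₀, h₁.trans h₃, h₂.symm.trans h₄⟩
  | _ => cases ha

theorem step_out_iff {s : S} {m : Nm s} {A : Tm ob (ob s)} {P P' : Proc ob} :
    Step (.out m A) P P' ↔ SC P (.par (.out m A) P') := by
  refine ⟨fun h => ?_, fun h =>
    .struct h (.parL P' (.out m A)) ((SC.par_comm _ _).trans (.par_nil _))⟩
  generalize ha : Act.out m A = a at h
  induction h with
  | out m A =>
    cases ha
    exact (SC.par_nil _).symm
  | parL Q _ ih =>
    have hP := ih ha
    subst ha
    exact hP.pull_left Q
  | parR Q _ ih =>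
    have hP := ih ha
    subst ha
    exact hP.pull_right Q
  | struct h₁ _ h₂ ih => exact h₁.trans ((ih ha).trans (.par (.refl _) h₂))
  | _ => cases ha

/-- Relatedness by `R` up to structural congruence on both sides. -/
def SCClosure (R : TermRel ob) : TermRel ob := fun _ X Y => ∃ P Q, SC X P ∧ R P Q ∧ SC Q Y

theorem SCClosure.of_rel {R : TermRel ob} {T : Ty S} {P Q : Tm ob T} (h : R P Q) :
    SCClosure R P Q :=
  ⟨P, Q, .refl P, h, .refl Q⟩

theorem SCClosure.mono {R R' : TermRel ob} (hR : ∀ ⦃T : Ty S⦄ ⦃A B : Tm ob T⦄, R A B → R' A B)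
    {T : Ty S} {P Q : Tm ob T} (h : SCClosure R P Q) : SCClosure R' P Q :=
  let ⟨_, _, hP, hPQ, hQ⟩ := h
  ⟨_, _, hP, hR hPQ, hQ⟩

/-- Bisimulations up to structural congruence, with a single clause for the observations of
processes: every top-level component is matched by one that gives rise to the same observation. -/
structure IsBisimulationUpToSC (R : TermRel ob) : Prop where
  symm : ∀ ⦃T : Ty S⦄ ⦃P Q : Tm ob T⦄, R P Q → R Q P
  non_abs : ∀ ⦃T : Ty S⦄ ⦃P Q : Tm ob T⦄, R P Q → ¬ P.IsAbs → ¬ Q.IsAbs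
  pabs : ∀ ⦃T : Ty S⦄ ⦃A : Proc ob⦄ ⦃Q : Tm ob (.pabs T)⦄, R (.pabs A) Q →
    ∃ B : Proc ob, Q = .pabs B ∧ R A B
  nabs : ∀ ⦃s : S⦄ ⦃A : Proc ob⦄ ⦃Q : Tm ob (.nabs s)⦄, R (.nabs A) Q →
    ∃ B : Proc ob, Q = .nabs B ∧ R A B
  var_abs : ∀ ⦃T : Ty S⦄, T ≠ .proc → ∀ ⦃i : ℕ⦄ ⦃Q : Tm ob T⦄, R (.var i) Q → Q = .var i
  component : ∀ ⦃P Q : Proc ob⦄, R P Q → ∀ (c : Component ob (Tm ob)) (P' : Proc ob),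
    SC P (.par c.toTm P') → ∃ (d : Component ob (Tm ob)) (Q' : Proc ob),
      SC Q (.par d.toTm Q') ∧ c.Match (SCClosure R) d ∧
        SCClosure R (c.residual P') (d.residual Q')

theorem IsHOIOBisimulation.isBisimulationUpToSC {R : TermRel ob} (hR : IsHOIOBisimulation R) :
    IsBisimulationUpToSC R where
  symm := hR.symm
  non_abs := hR.non_abs
  pabs := hR.pabs
  nabs := hR.nabs
  var_abs _ hT _ _ h := (hR.var_abs hT h _ (.refl _)).symm.var_left hT
  component P Q h c P' hc := by
    cases c with
    | inp m A =>
      obtain ⟨Q'', hQ, hPQ⟩ := hR.inp h m _ (step_inp_iff.2 ⟨A, P', hc, .refl _⟩)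
      obtain ⟨B, Q', hQ', hQ''⟩ := step_inp_iff.1 hQ
      exact ⟨.inp m B, Q', hQ', .inp _ _ _, _, _, .refl _, hPQ, hQ''⟩
    | out m A =>
      obtain ⟨B, Q', hQ, hAB, hPQ⟩ := hR.out h m A P' (step_out_iff.2 hc)
      exact ⟨.out m B, Q', step_out_iff.1 hQ, .out m (.of_rel hAB), .of_rel hPQ⟩
    | var i =>
      obtain ⟨Q', hQ, hPQ⟩ := hR.var h i P' hc
      exact ⟨.var i, Q', hQ, .var i, .of_rel hPQ⟩
    | papp i A =>
      obtain ⟨B, Q', hQ, hAB, hPQ⟩ := hR.papp h i A P' hc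
      exact ⟨.papp i B, Q', hQ, .papp i (.of_rel hAB), .of_rel hPQ⟩
    | napp i n =>
      obtain ⟨Q', hQ, hPQ⟩ := hR.napp h i n P' hc
      exact ⟨.napp i n, Q', hQ, .napp i n, .of_rel hPQ⟩

theorem IsBisimulationUpToSC.scClosure_component {R : TermRel ob} (hR : IsBisimulationUpToSC R)
    {P Q : Proc ob} (h : SCClosure R P Q) (c : Component ob (Tm ob)) (P' : Proc ob)
    (hc : SC P (.par c.toTm P')) : ∃ (d : Component ob (Tm ob)) (Q' : Proc ob),
      SC Q (.par d.toTm Q') ∧ c.Match (SCClosure R) d ∧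
        SCClosure R (c.residual P') (d.residual Q') := by
  obtain ⟨P₁, Q₁, hP, hPQ, hQ⟩ := h
  obtain ⟨d, Q', hd, hcd, hres⟩ := hR.component hPQ c P' (hP.symm.trans hc)
  exact ⟨d, Q', hQ.symm.trans hd, hcd, hres⟩

theorem IsBisimulationUpToSC.isHOIOBisimulation {R : TermRel ob} (hR : IsBisimulationUpToSC R) :
    IsHOIOBisimulation (SCClosure R) where
  symm := fun _ _ _ ⟨_, _, hP, h, hQ⟩ => ⟨_, _, hQ.symm, hR.symm h, hP.symm⟩
  non_abs := fun _ _ _ ⟨_, _, hP, h, hQ⟩ hn =>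
    hQ.isAbs_iff.not.1 (hR.non_abs h (hP.isAbs_iff.not.1 hn))
  pabs := fun _ _ _ ⟨_, _, hP, h, hQ⟩ => by
    obtain ⟨A, rfl, hA⟩ := hP.pabs_left
    obtain ⟨B, rfl, hAB⟩ := hR.pabs h
    obtain ⟨C, rfl, hC⟩ := hQ.pabs_left
    exact ⟨C, rfl, A, B, hA, hAB, hC⟩
  nabs := fun _ _ _ ⟨_, _, hP, h, hQ⟩ => by
    obtain ⟨A, rfl, hA⟩ := hP.nabs_left
    obtain ⟨B, rfl, hAB⟩ := hR.nabs h
    obtain ⟨C, rfl, hC⟩ := hQ.nabs_left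
    exact ⟨C, rfl, A, B, hA, hAB, hC⟩
  var_abs := fun _ hT _ _ ⟨_, _, hP, h, hQ⟩ i hi => by
    obtain rfl := (hi.symm.trans hP).var_left hT
    obtain rfl := hR.var_abs hT h
    exact hQ.symm
  out P Q h s m A P' hs := by
    obtain ⟨_, Q', hQ, hc, hPQ⟩ := hR.scClosure_component h (.out m A) P' (step_out_iff.1 hs)
    cases hc with | out _ hAB => exact ⟨_, Q', step_out_iff.2 hQ, hAB, hPQ⟩
  inp P Q h s m P' hs := by
    obtain ⟨A, P₀, hP, hP'⟩ := step_inp_iff.1 hs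
    obtain ⟨_, Q', hQ, hc, X, Y, hX, hXY, hY⟩ := hR.scClosure_component h (.inp m A) P₀ hP
    cases hc with
    | inp _ _ B =>
      exact ⟨_, step_inp_iff.2 ⟨B, Q', hQ, .refl _⟩, X, Y, hP'.trans hX, hXY, hY⟩
  var P Q h i P' hs := by
    obtain ⟨_, Q', hQ, hc, hPQ⟩ := hR.scClosure_component h (.var i) P' hs
    cases hc with | var => exact ⟨Q', hQ, hPQ⟩
  papp P Q h T i A P' hs := by
    obtain ⟨_, Q', hQ, hc, hPQ⟩ := hR.scClosure_component h (.papp i A) P' hs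
    cases hc with | papp _ hAB => exact ⟨_, Q', hQ, hAB, hPQ⟩
  napp P Q h s i n P' hs := by
    obtain ⟨_, Q', hQ, hc, hPQ⟩ := hR.scClosure_component h (.napp i n) P' hs
    cases hc with | napp => exact ⟨Q', hQ, hPQ⟩

theorem IsBisimulationUpToSC.bisim {R : TermRel ob} (hR : IsBisimulationUpToSC R) {T : Ty S}
    {P Q : Tm ob T} (h : R P Q) : Bisim P Q :=
  ⟨_, hR.isHOIOBisimulation, .of_rel h⟩

theorem isBisimulationUpToSC_eq : IsBisimulationUpToSC (fun T => @Eq (Tm ob T)) where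
  symm _ _ _ h := h.symm
  non_abs := by rintro T P _ rfl hP; exact hP
  pabs _ _ _ h := ⟨_, h.symm, rfl⟩
  nabs _ _ _ h := ⟨_, h.symm, rfl⟩
  var_abs _ _ _ _ h := h.symm
  component := by
    rintro P _ rfl c P' hc
    exact ⟨c, P', hc, .refl (fun _ _ => .of_rel rfl) c, .of_rel rfl⟩

theorem isBisimulationUpToSC_bisim : IsBisimulationUpToSC (@Bisim S ob) where
  symm := fun _ _ _ ⟨R, hR, h⟩ => ⟨R, hR, hR.symm h⟩
  non_abs := fun _ _ _ ⟨_, hR, h⟩ => hR.non_abs h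
  pabs := fun _ _ _ ⟨R, hR, h⟩ =>
    let ⟨B, hB, hAB⟩ := hR.pabs h
    ⟨B, hB, R, hR, hAB⟩
  nabs := fun _ _ _ ⟨R, hR, h⟩ =>
    let ⟨B, hB, hAB⟩ := hR.nabs h
    ⟨B, hB, R, hR, hAB⟩
  var_abs := fun _ hT _ _ ⟨_, hR, h⟩ => hR.isBisimulationUpToSC.var_abs hT h
  component := by
    rintro P Q ⟨R, hR, h⟩ c P' hc
    obtain ⟨d, Q', hQ, hcd, hres⟩ := hR.isBisimulationUpToSC.component h c P' hc
    have hR_bisim : ∀ ⦃T⦄ ⦃A B : Tm ob T⦄, R A B → Bisim A B := fun _ _ _ h => ⟨R, hR, h⟩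
    exact ⟨d, Q', hQ, hcd.mono fun _ _ _ => .mono hR_bisim, hres.mono hR_bisim⟩

theorem bisim_of_scClosure_bisim {T : Ty S} {P Q : Tm ob T} (h : SCClosure (@Bisim S ob) P Q) :
    Bisim P Q :=
  ⟨_, isBisimulationUpToSC_bisim.isHOIOBisimulation, h⟩

theorem Bisim.refl {T : Ty S} (P : Tm ob T) : Bisim P P := isBisimulationUpToSC_eq.bisim rfl

theorem Bisim.symm {T : Ty S} {P Q : Tm ob T} (h : Bisim P Q) : Bisim Q P :=
  isBisimulationUpToSC_bisim.symm h

theorem SC.bisim {T : Ty S} {P Q : Tm ob T} (h : SC P Q) : Bisim P Q :=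
  bisim_of_scClosure_bisim ⟨Q, Q, h, .refl Q, .refl Q⟩

theorem Bisim.component {P Q P' : Proc ob} (h : Bisim P Q) {c : Component ob (Tm ob)}
    (hc : SC P (.par c.toTm P')) :
    ∃ (d : Component ob (Tm ob)) (Q' : Proc ob), SC Q (.par d.toTm Q') ∧
      c.Match (@Bisim S ob) d ∧ Bisim (c.residual P') (d.residual Q') := by
  obtain ⟨d, Q', hQ, hcd, hres⟩ := isBisimulationUpToSC_bisim.component h c P' hc
  exact ⟨d, Q', hQ, hcd.mono fun _ _ _ => bisim_of_scClosure_bisim, bisim_of_scClosure_bisim hres⟩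

theorem isBisimulationUpToSC_bisim_comp :
    IsBisimulationUpToSC fun (T : Ty S) (P R : Tm ob T) => ∃ Q, Bisim P Q ∧ Bisim Q R where
  symm := fun _ _ _ ⟨Q, h₁, h₂⟩ => ⟨Q, h₂.symm, h₁.symm⟩
  non_abs := fun _ _ _ ⟨_, h₁, h₂⟩ h =>
    isBisimulationUpToSC_bisim.non_abs h₂ (isBisimulationUpToSC_bisim.non_abs h₁ h)
  pabs := fun _ _ _ ⟨_, h₁, h₂⟩ => by
    obtain ⟨B, rfl, hAB⟩ := isBisimulationUpToSC_bisim.pabs h₁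
    obtain ⟨C, rfl, hBC⟩ := isBisimulationUpToSC_bisim.pabs h₂
    exact ⟨C, rfl, B, hAB, hBC⟩
  nabs := fun _ _ _ ⟨_, h₁, h₂⟩ => by
    obtain ⟨B, rfl, hAB⟩ := isBisimulationUpToSC_bisim.nabs h₁
    obtain ⟨C, rfl, hBC⟩ := isBisimulationUpToSC_bisim.nabs h₂
    exact ⟨C, rfl, B, hAB, hBC⟩
  var_abs := fun _ hT _ _ ⟨_, h₁, h₂⟩ => by
    obtain rfl := isBisimulationUpToSC_bisim.var_abs hT h₁
    exact isBisimulationUpToSC_bisim.var_abs hT h₂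
  component := by
    rintro P R ⟨Q, h₁, h₂⟩ c P' hc
    obtain ⟨d, Q', hQ, hcd, hPQ⟩ := h₁.component hc
    obtain ⟨e, R', hR, hde, hQR⟩ := h₂.component hQ
    exact ⟨e, R', hR, hcd.comp (fun _ _ B _ h h' => .of_rel ⟨B, h, h'⟩) hde,
      .of_rel ⟨_, hPQ, hQR⟩⟩

theorem Bisim.trans {T : Ty S} {P Q R : Tm ob T} (h : Bisim P Q) (h' : Bisim Q R) : Bisim P R :=
  isBisimulationUpToSC_bisim_comp.bisim ⟨Q, h, h'⟩

/-- Renamings of bisimilar terms. -/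
def RenameRel ⦃T : Ty S⦄ (X Y : Tm ob T) : Prop :=
  ∃ (P Q : Tm ob T) (p : Ren (Ty S)) (r : Ren S),
    Bisim P Q ∧ X = P.rename p r ∧ Y = Q.rename p r

theorem RenameRel.component {P Q : Proc ob} (h : RenameRel P Q) (c : Component ob (Tm ob))
    (P' : Proc ob) (hc : SC P (.par c.toTm P')) : ∃ (d : Component ob (Tm ob)) (Q' : Proc ob),
      SC Q (.par d.toTm Q') ∧ c.Match (SCClosure RenameRel) d ∧
        SCClosure RenameRel (c.residual P') (d.residual Q') := by
  obtain ⟨P, Q, p, r, h, rfl, rfl⟩ := h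
  obtain ⟨c₀, P₀, hP₀, hmk, hP'⟩ := hc.exists_of_rename
  obtain ⟨d₀, Q₀, hQ₀, hmatch, hres⟩ := h.component hP₀
  refine ⟨d₀.rename p r, Q₀.rename p r, ?_, ?_, ?_⟩
  · simpa only [Tm.rename, Component.rename_toTm] using hQ₀.rename p r
  · have hren : (c₀.rename p r).Match RenameRel (d₀.rename p r) :=
      hmatch.rename fun _ A B hAB => ⟨A, B, p, r, hAB, rfl, rfl⟩
    exact (Component.match_of_mk_eq hmk.symm).comp
      (fun _ _ _ _ hAB hBC => ⟨_, _, hAB, hBC, .refl _⟩) hren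
  · refine ⟨_, _, Component.residual_congr hmk.symm hP', ?_, .refl _⟩
    rw [c₀.residual_rename, d₀.residual_rename, hmatch.liftRen_eq]
    exact ⟨_, _, _, r, hres, rfl, rfl⟩

theorem Tm.isAbs_rename {T : Ty S} (P : Tm ob T) (p : Ren (Ty S)) (r : Ren S) :
    (P.rename p r).IsAbs ↔ P.IsAbs := by
  cases P <;> rfl

theorem isBisimulationUpToSC_renameRel : IsBisimulationUpToSC (RenameRel (ob := ob)) where
  symm := fun _ _ _ ⟨P, Q, p, r, h, hX, hY⟩ => ⟨Q, P, p, r, h.symm, hY, hX⟩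
  non_abs := by
    rintro T _ _ ⟨P, Q, p, r, h, rfl, rfl⟩ hn
    rw [Tm.isAbs_rename] at hn ⊢
    exact isBisimulationUpToSC_bisim.non_abs h hn
  pabs := by
    rintro T A _ ⟨P, Q, p, r, h, hA, rfl⟩
    cases P <;> cases hA
    obtain ⟨Q, rfl, hPQ⟩ := isBisimulationUpToSC_bisim.pabs h
    exact ⟨_, rfl, _, Q, p.lift T, r, hPQ, rfl, rfl⟩
  nabs := by
    rintro s A _ ⟨P, Q, p, r, h, hA, rfl⟩
    cases P <;> cases hA
    obtain ⟨Q, rfl, hPQ⟩ := isBisimulationUpToSC_bisim.nabs h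
    exact ⟨_, rfl, _, Q, p, r.lift s, hPQ, rfl, rfl⟩
  var_abs := by
    rintro T hT i _ ⟨P, Q, p, r, h, hP, rfl⟩
    cases P <;> cases hP
    obtain rfl := isBisimulationUpToSC_bisim.var_abs hT h
    rfl
  component _ _ := RenameRel.component

theorem Bisim.rename {T : Ty S} {P Q : Tm ob T} (h : Bisim P Q) (p : Ren (Ty S)) (r : Ren S) :
    Bisim (P.rename p r) (Q.rename p r) :=
  isBisimulationUpToSC_renameRel.bisim ⟨P, Q, p, r, h, rfl, rfl⟩

theorem Bisim.frame {P Q : Proc ob} (h : Bisim P Q) (c : Component ob (Tm ob)) :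
    Bisim (c.frame P) (c.frame Q) := by
  cases c with
  | inp => exact h.rename _ _
  | _ => exact h

/-- Parallel compositions of bisimilar processes, and bisimilar terms. -/
inductive ParRel : TermRel ob
  | par {P P' Q Q' : Proc ob} : Bisim P P' → Bisim Q Q' → ParRel (.par P Q) (.par P' Q')
  | bisim {T : Ty S} {P Q : Tm ob T} : Bisim P Q → ParRel P Q

theorem ParRel.component {P Q : Proc ob} (h : ParRel P Q) (c : Component ob (Tm ob))
    (P' : Proc ob) (hc : SC P (.par c.toTm P')) : ∃ (d : Component ob (Tm ob)) (Q' : Proc ob),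
      SC Q (.par d.toTm Q') ∧ c.Match (SCClosure ParRel) d ∧
        SCClosure ParRel (c.residual P') (d.residual Q') := by
  have hbisim : ∀ ⦃T⦄ ⦃A B : Tm ob T⦄, Bisim A B → SCClosure ParRel A B :=
    fun _ _ _ h => .of_rel (.bisim h)
  cases h with
  | @par P₁ Q₁ P₂ Q₂ hP hQ =>
    rcases hc.par_split with ⟨P₁', hP₁, hR⟩ | ⟨P₂', hP₂, hR⟩
    · obtain ⟨d, Q₁', hQ₁, hcd, hres⟩ := hP.component hP₁
      refine ⟨d, .par Q₁' Q₂, hQ₁.pull_left Q₂, hcd.mono hbisim, _, _,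
        (Component.residual_congr rfl hR).trans (c.residual_par_left P₁' P₂), ?_,
        (d.residual_par_left Q₁' Q₂).symm⟩
      exact .par hres (hcd.frame_eq ▸ hQ.frame c)
    · obtain ⟨d, Q₂', hQ₂, hcd, hres⟩ := hQ.component hP₂
      refine ⟨d, .par Q₁ Q₂', hQ₂.pull_right Q₁, hcd.mono hbisim, _, _,
        (Component.residual_congr rfl hR).trans (c.residual_par_right P₁ P₂'), ?_,
        (d.residual_par_right Q₁ Q₂').symm⟩
      exact .par (hcd.frame_eq ▸ hP.frame c) hres
  | bisim h =>
    obtain ⟨d, Q', hQ, hcd, hres⟩ := h.component hc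
    exact ⟨d, Q', hQ, hcd.mono hbisim, hbisim hres⟩

theorem isBisimulationUpToSC_parRel : IsBisimulationUpToSC (ParRel (ob := ob)) where
  symm := by
    rintro T _ _ (⟨hP, hQ⟩ | h)
    · exact .par hP.symm hQ.symm
    · exact .bisim h.symm
  non_abs := by
    rintro T _ _ (_ | h) hn
    · exact id
    · exact isBisimulationUpToSC_bisim.non_abs h hn
  pabs := by
    rintro T A _ (_ | h)
    obtain ⟨B, rfl, hAB⟩ := isBisimulationUpToSC_bisim.pabs h
    exact ⟨B, rfl, .bisim hAB⟩
  nabs := by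
    rintro s A _ (_ | h)
    obtain ⟨B, rfl, hAB⟩ := isBisimulationUpToSC_bisim.nabs h
    exact ⟨B, rfl, .bisim hAB⟩
  var_abs := by
    rintro T hT i _ (_ | h)
    exact isBisimulationUpToSC_bisim.var_abs hT h
  component _ _ := ParRel.component

theorem Bisim.par {P P' Q Q' : Proc ob} (h₁ : Bisim P P') (h₂ : Bisim Q Q') :
    Bisim (.par P Q) (.par P' Q') :=
  isBisimulationUpToSC_parRel.bisim (.par h₁ h₂)

theorem SC.size_eq_add {P P' : Proc ob} {c : Component ob (Tm ob)}
    (h : SC P (.par c.toTm P')) : P.size = c.size + P'.size := by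
  rw [h.size_eq, Tm.size_par, c.size_toTm]

theorem Tm.sc_nil_of_size_eq_zero {P : Proc ob} (h : P.size = 0) : SC P .nil := by
  refine P.sc_nil_or_component.resolve_right fun ⟨c, P', hc⟩ => ?_
  have hlt := c.size_residual_lt P'
  rw [← hc.size_eq_add, h] at hlt
  exact Nat.not_lt_zero _ hlt

theorem Bisim.sc_nil {P : Proc ob} (h : Bisim .nil P) : SC P .nil := by
  refine P.sc_nil_or_component.resolve_right fun ⟨c, P', hc⟩ => ?_
  obtain ⟨d, R, hR, -⟩ := h.symm.component hc
  exact not_sc_nil_par hR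

theorem Bisim.size_eq_of_size_lt {P Q : Proc ob} (h : Bisim P Q)
    (ih : ∀ ⦃T : Ty S⦄ ⦃A B : Tm ob T⦄, A.size < P.size → Bisim A B → A.size = B.size) :
    P.size = Q.size := by
  rcases P.sc_nil_or_component with hP | ⟨c, P', hP⟩
  · rw [hP.size_eq, (hP.symm.bisim.trans h).sc_nil.size_eq]
  · obtain ⟨d, Q', hQ, hcd, hres⟩ := h.component hP
    rw [hP.size_eq_add] at ih ⊢
    rw [hQ.size_eq_add]
    exact (hcd.mono_of_size_lt fun _ _ _ hlt => ih (Nat.lt_add_right _ hlt)).size_add_eq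
      (ih (c.size_residual_lt P') hres)

theorem Bisim.size_eq {T : Ty S} {P Q : Tm ob T} (h : Bisim P Q) : P.size = Q.size := by
  induction hn : P.size using Nat.strong_induction_on generalizing T P Q with
  | _ n ih =>
    subst hn
    cases P with
    | pabs A =>
      obtain ⟨B, rfl, hAB⟩ := isBisimulationUpToSC_bisim.pabs h
      rw [Tm.size_pabs] at ih ⊢
      rw [Tm.size_pabs, ih _ (Nat.lt_succ_self _) hAB rfl]
    | nabs A =>
      obtain ⟨B, rfl, hAB⟩ := isBisimulationUpToSC_bisim.nabs h
      rw [Tm.size_nabs] at ih ⊢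
      rw [Tm.size_nabs, ih _ (Nat.lt_succ_self _) hAB rfl]
    | var i =>
      by_cases hT : T = .proc
      · subst hT
        exact h.size_eq_of_size_lt fun _ _ _ hlt hAB => ih _ hlt hAB rfl
      · rw [isBisimulationUpToSC_bisim.var_abs hT h]
    | _ => exact h.size_eq_of_size_lt fun _ _ _ hlt hAB => ih _ hlt hAB rfl

end Bisimilarity

/-! ### Unique decomposition in monoids with transitions -/

section UniqueDecomposition

theorem exists_heaviest_count_ne {α β : Type*} [DecidableEq α] [LinearOrder β] {s t : Multiset α}
    (f : α → β) (h : s ≠ t) :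
    ∃ c, s.count c ≠ t.count c ∧ ∀ x, s.count x ≠ t.count x → f x ≤ f c := by
  have hfin : {x | s.count x ≠ t.count x}.Finite :=
    (s + t).toFinset.finite_toSet.subset fun x hx => by
      simp only [Finset.mem_coe, Multiset.mem_toFinset, ← Multiset.count_pos, Multiset.count_add]
      grind
  exact Set.exists_max_image _ f hfin (not_forall.1 (mt Multiset.ext.2 h))

variable {M Λ : Type*} [AddCommMonoid M]

/-- A commutative monoid with an additive weight that vanishes at zero only, and with labelled
transitions that decrease the weight.  A transition of a sum is a transition of one summand, while
the other summands are moved along the embedding `frame`; the left inverse `retract` of `frame`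
need not respect the transitions. -/
structure DecompositionSystem (M Λ : Type*) [AddCommMonoid M] where
  weight : M →+ ℕ
  Tr : Λ → M → M → Prop
  frame : Λ → M →+ M
  retract : Λ → M →+ M
  eq_zero_of_weight_eq_zero : ∀ {x}, weight x = 0 → x = 0
  weight_retract : ∀ l x, weight (retract l x) = weight x
  retract_frame : ∀ l x, retract l (frame l x) = x
  weight_lt : ∀ {l x x'}, Tr l x x' → weight x' < weight x
  exists_tr : ∀ {x}, x ≠ 0 → ∃ l x', Tr l x x'
  tr_add_right : ∀ {l x x'}, Tr l x x' → ∀ y, Tr l (x + y) (x' + frame l y)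
  tr_add : ∀ {l x y z}, Tr l (x + y) z →
    (∃ x', Tr l x x' ∧ z = x' + frame l y) ∨ (∃ y', Tr l y y' ∧ z = y' + frame l x)

namespace DecompositionSystem

variable (D : DecompositionSystem M Λ)

theorem isAddUnit_iff (D : DecompositionSystem M Λ) {x : M} : IsAddUnit x ↔ x = 0 :=
  ⟨fun h => D.eq_zero_of_weight_eq_zero (Nat.isAddUnit_iff.1 (h.map D.weight)),
    fun h => h ▸ isAddUnit_zero⟩

theorem addIrreducible_iff (D : DecompositionSystem M Λ) {x : M} :
    AddIrreducible x ↔ x ≠ 0 ∧ ∀ ⦃y z⦄, x = y + z → y = 0 ∨ z = 0 := by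
  simp only [_root_.addIrreducible_iff, D.isAddUnit_iff, ne_eq]

theorem weight_pos {x : M} (hx : AddIrreducible x) : 0 < D.weight x :=
  Nat.pos_of_ne_zero fun h => (D.addIrreducible_iff.1 hx).1 (D.eq_zero_of_weight_eq_zero h)

theorem weight_frame (l : Λ) (x : M) : D.weight (D.frame l x) = D.weight x := by
  rw [← D.weight_retract l, D.retract_frame]

theorem frame_injective (l : Λ) : Function.Injective (D.frame l) :=
  Function.LeftInverse.injective (D.retract_frame l)

theorem addIrreducible_frame (l : Λ) {x : M} (hx : AddIrreducible x) :
    AddIrreducible (D.frame l x) := by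
  rw [D.addIrreducible_iff] at hx ⊢
  refine ⟨fun h => hx.1 ?_, fun y z h => ?_⟩
  · rw [← D.retract_frame l x, h, map_zero]
  · have eq_zero {y : M} (hy : D.retract l y = 0) : y = 0 :=
      D.eq_zero_of_weight_eq_zero (by rw [← D.weight_retract l, hy, map_zero])
    exact (hx.2 (by rw [← map_add, ← h, D.retract_frame])).imp eq_zero eq_zero

theorem weight_le_of_mem {s : Multiset M} {a : M} (ha : a ∈ s) : D.weight a ≤ D.weight s.sum := by
  obtain ⟨t, rfl⟩ := Multiset.exists_cons_of_mem ha
  simp only [Multiset.sum_cons, map_add, le_add_iff_nonneg_right, zero_le]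

theorem card_le_weight_sum {s : Multiset M} (hs : ∀ a ∈ s, AddIrreducible a) :
    s.card ≤ D.weight s.sum := by
  rw [map_multiset_sum, ← Multiset.card_map D.weight, ← mul_one (Multiset.card _), ← smul_eq_mul]
  refine Multiset.card_nsmul_le_sum fun n hn => ?_
  obtain ⟨a, ha, rfl⟩ := Multiset.mem_map.1 hn
  exact D.weight_pos (hs a ha)

theorem eq_sum_of_mem (D : DecompositionSystem M Λ) {t : Multiset M} {b : M}
    (ht : ∀ a ∈ t, AddIrreducible a) (hsum : AddIrreducible t.sum) (hb : b ∈ t) : b = t.sum := by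
  obtain ⟨t, rfl⟩ := Multiset.exists_cons_of_mem hb
  rw [Multiset.sum_cons] at hsum ⊢
  rcases (D.addIrreducible_iff.1 hsum).2 rfl with h0 | h0
  · exact absurd h0 (D.addIrreducible_iff.1 (ht b hb)).1
  · rw [h0, add_zero]

theorem exists_addIrreducible_decomposition (D : DecompositionSystem M Λ) (x : M) :
    ∃ s : Multiset M, (∀ a ∈ s, AddIrreducible a) ∧ s.sum = x := by
  induction hn : D.weight x using Nat.strong_induction_on generalizing x with
  | _ n ih =>
    by_cases hx : AddIrreducible x
    · exact ⟨{x}, by simpa using hx, by simp⟩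
    by_cases h0 : x = 0
    · exact ⟨0, by simp, by simp [h0]⟩
    obtain ⟨y, z, rfl, hy, hz⟩ : ∃ y z, x = y + z ∧ y ≠ 0 ∧ z ≠ 0 := by
      simpa only [D.addIrreducible_iff, ne_eq, h0, not_false_eq_true, true_and, not_forall,
        not_or, exists_prop] using hx
    have hy' := Nat.pos_of_ne_zero (hy ∘ D.eq_zero_of_weight_eq_zero)
    have hz' := Nat.pos_of_ne_zero (hz ∘ D.eq_zero_of_weight_eq_zero)
    rw [map_add] at hn
    obtain ⟨s, hs, rfl⟩ := ih _ (by omega) y rfl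
    obtain ⟨t, ht, rfl⟩ := ih _ (by omega) z rfl
    exact ⟨s + t, fun a ha => (Multiset.mem_add.1 ha).elim (hs a) (ht a), Multiset.sum_add s t⟩

open Classical in
theorem exists_tr_of_tr_sum {l : Λ} {s : Multiset M} {z : M} (h : D.Tr l s.sum z) :
    ∃ a ∈ s, ∃ a', D.Tr l a a' ∧ z = a' + D.frame l (s.erase a).sum := by
  induction s using Multiset.induction_on generalizing z with
  | empty => exact absurd (D.weight_lt h) (by simp)
  | cons b s ih =>
    rw [Multiset.sum_cons] at h
    rcases D.tr_add h with ⟨b', hb, rfl⟩ | ⟨y, hy, rfl⟩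
    · exact ⟨b, by simp, b', hb, by simp⟩
    · obtain ⟨a, ha, a', haa', rfl⟩ := ih hy
      refine ⟨a, by simp [ha], a', haa', ?_⟩
      rw [Multiset.erase_cons_tail_of_mem ha, Multiset.sum_cons, map_add, add_assoc,
        add_comm (D.frame l b)]

open Classical in
theorem tr_sum_of_mem {l : Λ} {s : Multiset M} {a a' : M} (ha : a ∈ s) (h : D.Tr l a a') :
    D.Tr l s.sum (a' + D.frame l (s.erase a).sum) := by
  simpa only [← Multiset.sum_cons, Multiset.cons_erase ha] using
    D.tr_add_right h (s.erase a).sum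

/-- A decomposition of `x` into irreducible elements; which one is chosen only matters as long as
decompositions are not known to be unique. -/
noncomputable def parts (x : M) : Multiset M := (D.exists_addIrreducible_decomposition x).choose

theorem addIrreducible_of_mem_parts {x a : M} (ha : a ∈ D.parts x) : AddIrreducible a :=
  (D.exists_addIrreducible_decomposition x).choose_spec.1 a ha

theorem sum_parts (x : M) : (D.parts x).sum = x :=
  (D.exists_addIrreducible_decomposition x).choose_spec.2

open Classical in
/-- The multiplicity of `c` in `x` after a transition labelled `l`, which has turned `c` into
`frame l c`. -/
noncomputable def copies (l : Λ) (c x : M) : ℕ := (D.parts x).count (D.frame l c)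

theorem copies_le_weight (l : Λ) (c x : M) : D.copies l c x ≤ D.weight x := by
  classical
  calc D.copies l c x ≤ (D.parts x).card := Multiset.count_le_card _ _
    _ ≤ D.weight (D.parts x).sum :=
      D.card_le_weight_sum fun _ => D.addIrreducible_of_mem_parts
    _ = D.weight x := by rw [D.sum_parts]

theorem copies_eq_zero_of_weight_lt {l : Λ} {c x : M} (h : D.weight x < D.weight c) :
    D.copies l c x = 0 := by
  classical
  refine Multiset.count_eq_zero.2 fun hmem => ?_
  have := D.weight_le_of_mem hmem
  rw [D.sum_parts, D.weight_frame] at this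
  omega

/-- Decompositions of elements of weight less than `N` are unique. -/
def UniqueBelow (N : ℕ) : Prop :=
  ∀ s t : Multiset M, (∀ a ∈ s, AddIrreducible a) → (∀ a ∈ t, AddIrreducible a) →
    s.sum = t.sum → D.weight s.sum < N → s = t

variable {D} {s t : Multiset M} {c : M}

open Classical in
theorem addIrreducible_of_mem_parts_add_map_frame (hs : ∀ a ∈ s, AddIrreducible a) {l : Λ}
    {x a a' : M} (hx : x ∈ D.parts a' + (s.erase a).map (D.frame l)) : AddIrreducible x := by
  rcases Multiset.mem_add.1 hx with hx | hx
  · exact D.addIrreducible_of_mem_parts hx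
  · obtain ⟨y, hy, rfl⟩ := Multiset.mem_map.1 hx
    exact D.addIrreducible_frame l (hs y (Multiset.mem_of_mem_erase hy))

open Classical in
theorem UniqueBelow.exists_tr_copies_eq (hU : D.UniqueBelow (D.weight s.sum))
    (hs : ∀ a ∈ s, AddIrreducible a) (ht : ∀ a ∈ t, AddIrreducible a) (hst : s.sum = t.sum)
    {l : Λ} {a a' : M} (ha : a ∈ s) (haa' : D.Tr l a a') :
    ∃ b ∈ t, ∃ b', D.Tr l b b' ∧ ∀ c,
      D.copies l c a' + (s.erase a).count c = D.copies l c b' + (t.erase b).count c := by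
  have htr := D.tr_sum_of_mem ha haa'
  obtain ⟨b, hb, b', hbb', hsum⟩ := D.exists_tr_of_tr_sum (hst ▸ htr)
  have hparts : D.parts a' + (s.erase a).map (D.frame l) =
      D.parts b' + (t.erase b).map (D.frame l) := by
    refine hU _ _ (fun _ => addIrreducible_of_mem_parts_add_map_frame hs)
      (fun _ => addIrreducible_of_mem_parts_add_map_frame ht) ?_ ?_
    · simpa only [Multiset.sum_add, D.sum_parts, ← map_multiset_sum] using hsum
    · simpa only [Multiset.sum_add, D.sum_parts, ← map_multiset_sum] using D.weight_lt htr
  refine ⟨b, hb, b', hbb', fun c => ?_⟩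
  simpa only [copies, Multiset.count_add,
    Multiset.count_map_eq_count' _ _ (D.frame_injective l)] using
    congrArg (Multiset.count (D.frame l c)) hparts

open Classical in
theorem UniqueBelow.exists_copies_lt (hU : D.UniqueBelow (D.weight s.sum))
    (hs : ∀ a ∈ s, AddIrreducible a) (ht : ∀ a ∈ t, AddIrreducible a) (hst : s.sum = t.sum)
    (hc : ∀ x, s.count x ≠ t.count x → D.weight x ≤ D.weight c) (hlt : t.count c < s.count c)
    {l : Λ} {a a' : M} (ha : a ∈ s) (hac : a ≠ c) (haa' : D.Tr l a a') :
    ∃ b ∈ s, b ≠ c ∧ ∃ b', D.Tr l b b' ∧ D.copies l c a' < D.copies l c b' := by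
  obtain ⟨b, hb, b', hbb', hcount⟩ := hU.exists_tr_copies_eq hs ht hst ha haa'
  specialize hcount c
  rw [Multiset.count_erase_of_ne hac.symm] at hcount
  have hw := D.weight_lt hbb'
  have hbc : b ≠ c := by
    rintro rfl
    rw [D.copies_eq_zero_of_weight_lt hw, Multiset.count_erase_self] at hcount
    omega
  rw [Multiset.count_erase_of_ne hbc.symm] at hcount
  have hcb : D.weight c ≤ D.weight b' := by
    by_contra! hlt'
    rw [D.copies_eq_zero_of_weight_lt hlt'] at hcount
    omega
  have hbs : s.count b = t.count b := by
    by_contra hne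
    have := hc b hne
    omega
  exact ⟨b, Multiset.count_pos.1 (hbs ▸ Multiset.count_pos.2 hb), hbc, b', hbb', by omega⟩

open Classical in
theorem UniqueBelow.eq_of_mem_of_count_lt (hU : D.UniqueBelow (D.weight s.sum))
    (hs : ∀ a ∈ s, AddIrreducible a) (ht : ∀ a ∈ t, AddIrreducible a) (hst : s.sum = t.sum)
    (hc : ∀ x, s.count x ≠ t.count x → D.weight x ≤ D.weight c) (hlt : t.count c < s.count c) :
    ∀ a ∈ s, a = c := by
  by_contra! ⟨a, ha, hac⟩
  obtain ⟨l, a', haa'⟩ := D.exists_tr (D.addIrreducible_iff.1 (hs a ha)).1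
  have unbounded (n : ℕ) : ∃ b ∈ s, b ≠ c ∧ ∃ b', D.Tr l b b' ∧ n ≤ D.copies l c b' := by
    induction n with
    | zero => exact ⟨a, ha, hac, a', haa', Nat.zero_le _⟩
    | succ n ih =>
      obtain ⟨b, hb, hbc, b', hbb', hn⟩ := ih
      obtain ⟨d, hd, hdc, d', hdd', hbd⟩ := hU.exists_copies_lt hs ht hst hc hlt hb hbc hbb'
      exact ⟨d, hd, hdc, d', hdd', by omega⟩
  obtain ⟨b, hb, -, b', hbb', hn⟩ := unbounded (D.weight s.sum)
  have h₁ := D.weight_lt hbb'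
  have h₂ := D.weight_le_of_mem hb
  have h₃ := D.copies_le_weight l c b'
  omega

open Classical in
theorem UniqueBelow.count_erase_eq_of_forall_eq (hU : D.UniqueBelow (D.weight s.sum))
    (hs : ∀ a ∈ s, AddIrreducible a) (ht : ∀ a ∈ t, AddIrreducible a) (hst : s.sum = t.sum)
    (hall : ∀ a ∈ s, a = c) {b : M} (hb : b ∈ t) (hbc : D.weight b ≤ D.weight c) :
    (t.erase b).count c = (s.erase c).count c := by
  obtain ⟨l, b', hbb'⟩ := D.exists_tr (D.addIrreducible_iff.1 (ht b hb)).1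
  obtain ⟨a, ha, a', haa', hcount⟩ :=
    UniqueBelow.exists_tr_copies_eq (hst ▸ hU) ht hs hst.symm hb hbb'
  obtain rfl := hall a ha
  have := hcount a
  rwa [D.copies_eq_zero_of_weight_lt (D.weight_lt haa'),
    D.copies_eq_zero_of_weight_lt ((D.weight_lt hbb').trans_le hbc), zero_add, zero_add] at this

open Classical in
theorem UniqueBelow.not_count_lt (hU : D.UniqueBelow (D.weight s.sum))
    (hs : ∀ a ∈ s, AddIrreducible a) (ht : ∀ a ∈ t, AddIrreducible a) (hst : s.sum = t.sum)
    (hc : ∀ x, s.count x ≠ t.count x → D.weight x ≤ D.weight c) :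
    ¬ t.count c < s.count c := by
  intro hlt
  have hall := hU.eq_of_mem_of_count_lt hs ht hst hc hlt
  have hcs : c ∈ s := Multiset.count_pos.1 (by omega)
  have count_erase_eq {b : M} (hb : b ∈ t) : (t.erase b).count c = (s.erase c).count c := by
    refine hU.count_erase_eq_of_forall_eq hs ht hst hall hb ?_
    by_cases hbc : b = c
    · rw [hbc]
    · refine hc b ?_
      rw [Multiset.count_eq_zero.2 fun h => hbc (hall b h)]
      exact (Multiset.count_pos.2 hb).ne
  have hct : c ∉ t := fun h => by
    have := count_erase_eq h
    have := Multiset.count_pos.2 h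
    simp only [Multiset.count_erase_self] at *
    omega
  obtain ⟨b, hb⟩ : ∃ b, b ∈ t := Multiset.exists_mem_of_ne_zero fun h0 => by
    have := (D.weight_pos (hs c hcs)).trans_le (D.weight_le_of_mem hcs)
    simp [hst, h0] at this
  have hbc : b ≠ c := fun h => hct (h ▸ hb)
  have hcard : s.card = 1 := by
    have := count_erase_eq hb
    rw [Multiset.count_erase_of_ne hbc.symm, Multiset.count_eq_zero.2 hct,
      Multiset.count_erase_self] at this
    rw [← Multiset.count_eq_card.2 fun a ha => (hall a ha).symm]
    omega
  obtain ⟨x, rfl⟩ := Multiset.card_eq_one.1 hcard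
  obtain rfl := Multiset.mem_singleton.1 hcs
  rw [Multiset.sum_singleton] at hst
  exact hbc ((D.eq_sum_of_mem ht (hst ▸ hs c hcs) hb).trans hst.symm)

theorem eq_of_sum_eq (D : DecompositionSystem M Λ) (hs : ∀ a ∈ s, AddIrreducible a)
    (ht : ∀ a ∈ t, AddIrreducible a) (hst : s.sum = t.sum) : s = t := by
  classical
  induction hn : D.weight s.sum using Nat.strong_induction_on generalizing s t with
  | _ n ih =>
    have hU : D.UniqueBelow (D.weight s.sum) := fun s' t' hs' ht' h hw =>
      ih _ (hn ▸ hw) hs' ht' h rfl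
    by_contra hne
    obtain ⟨c, hc, hmax⟩ := exists_heaviest_count_ne D.weight hne
    rcases hc.lt_or_gt with hlt | hlt
    · exact UniqueBelow.not_count_lt (hst ▸ hU) ht hs hst.symm (fun x hx => hmax x hx.symm) hlt
    · exact hU.not_count_lt hs ht hst hmax hlt

end DecompositionSystem

end UniqueDecomposition

/-! ### Prime decomposition of processes -/

section Decomposition

variable {S : Type u} {ob : S → Ty S}

/-- Bisimilarity as a setoid. -/
def bisimSetoid (ob : S → Ty S) (T : Ty S) : Setoid (Tm ob T) where
  r := Bisim
  iseqv := ⟨.refl, .symm, .trans⟩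

/-- Terms modulo bisimilarity. -/
def BisimClass (ob : S → Ty S) (T : Ty S) : Type u := Quotient (bisimSetoid ob T)

/-- The class of a term modulo bisimilarity. -/
def Tm.bisimClass {T : Ty S} (P : Tm ob T) : BisimClass ob T := Quotient.mk _ P

theorem Tm.bisimClass_eq_iff {T : Ty S} {P Q : Tm ob T} :
    P.bisimClass = Q.bisimClass ↔ Bisim P Q :=
  ⟨fun h => Quotient.exact h, fun h => Quotient.sound h⟩

theorem SC.bisimClass_eq {T : Ty S} {P Q : Tm ob T} (h : SC P Q) : P.bisimClass = Q.bisimClass :=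
  Tm.bisimClass_eq_iff.2 h.bisim

theorem BisimClass.ind {T : Ty S} {p : BisimClass ob T → Prop} (h : ∀ P : Tm ob T, p P.bisimClass)
    (x : BisimClass ob T) : p x :=
  Quotient.ind h x

instance : Add (BisimClass ob .proc) :=
  ⟨Quotient.map₂ Tm.par fun _ _ h₁ _ _ h₂ => Bisim.par h₁ h₂⟩

instance : Zero (BisimClass ob .proc) := ⟨Tm.nil.bisimClass⟩

theorem Tm.bisimClass_par (P Q : Proc ob) :
    (Tm.par P Q).bisimClass = P.bisimClass + Q.bisimClass := rfl

instance : AddCommMonoid (BisimClass ob .proc) where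
  add_assoc := BisimClass.ind fun P => BisimClass.ind fun Q => BisimClass.ind fun R =>
    (SC.par_assoc P Q R).bisimClass_eq
  zero_add := BisimClass.ind fun P => ((SC.par_comm .nil P).trans (.par_nil P)).bisimClass_eq
  add_zero := BisimClass.ind fun P => (SC.par_nil P).bisimClass_eq
  add_comm := BisimClass.ind fun P => BisimClass.ind fun Q => (SC.par_comm P Q).bisimClass_eq
  nsmul := nsmulRec

namespace BisimClass

/-- The size of a class of processes, which does not depend on the representative. -/
noncomputable def size : BisimClass ob .proc →+ ℕ where
  toFun := Quotient.lift Tm.size fun _ _ => Bisim.size_eq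
  map_zero' := Tm.size_nil
  map_add' := BisimClass.ind fun P => BisimClass.ind fun Q => Tm.size_par P Q

theorem size_bisimClass (P : Proc ob) : size P.bisimClass = P.size := rfl

theorem eq_zero_of_size_eq_zero {x : BisimClass ob .proc} (h : size x = 0) : x = 0 := by
  induction x using BisimClass.ind with
  | h P => exact (Tm.sc_nil_of_size_eq_zero h).bisimClass_eq

/-- Renaming of the process variables of a class of processes. -/
noncomputable def rename (p : Ren (Ty S)) : BisimClass ob .proc →+ BisimClass ob .proc where
  toFun := Quotient.map (fun P => P.rename p Ren.id) fun _ _ h => Bisim.rename h _ _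
  map_zero' := rfl
  map_add' := BisimClass.ind fun _ => BisimClass.ind fun _ => rfl

theorem rename_bisimClass (P : Proc ob) (p : Ren (Ty S)) :
    rename p P.bisimClass = (P.rename p Ren.id).bisimClass := rfl

theorem size_rename (p : Ren (Ty S)) (x : BisimClass ob .proc) : size (rename p x) = size x := by
  induction x using BisimClass.ind with
  | h P => rw [rename_bisimClass, size_bisimClass, size_bisimClass, Tm.size_rename]

theorem rename_cons_rename_shift (T : Ty S) (i : ℕ) (x : BisimClass ob .proc) :
    rename (cons (K := fun _ => ℕ) T i Ren.id) (rename (Ren.shift T) x) = x := by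
  induction x using BisimClass.ind with
  | h P =>
    rw [rename_bisimClass, rename_bisimClass, Tm.rename_rename]
    simp only [cons_shift]
    exact congrArg Tm.bisimClass P.rename_id

end BisimClass

namespace Component

/-- The observation that a component gives rise to.  The body of an input is not observed; `0` is a
placeholder for it. -/
def label : Component ob (Tm ob) → Component ob (BisimClass ob)
  | .inp m _ => .inp m 0
  | .out m A => .out m A.bisimClass
  | .var i => .var i
  | .papp i A => .papp i A.bisimClass
  | .napp i n => .napp i n

theorem Match.label_eq {c d : Component ob (Tm ob)} (h : c.Match (@Bisim S ob) d) :
    c.label = d.label := by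
  cases h with
  | out m h => simp only [label, Tm.bisimClass_eq_iff.2 h]
  | papp i h => simp only [label, Tm.bisimClass_eq_iff.2 h]
  | _ => rfl

/-- What the class of a process becomes when a component in parallel to it is consumed. -/
noncomputable def classFrame :
    Component ob (BisimClass ob) → (BisimClass ob .proc →+ BisimClass ob .proc)
  | .inp (s := s) _ _ => BisimClass.rename (Ren.shift (ob s))
  | _ => .id _

/-- A left inverse of `classFrame`, which maps the variable bound by an input to an arbitrary
one. -/
noncomputable def classRetract :
    Component ob (BisimClass ob) → (BisimClass ob .proc →+ BisimClass ob .proc)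
  | .inp (s := s) _ _ => BisimClass.rename (cons (K := fun _ => ℕ) (ob s) 0 Ren.id)
  | _ => .id _

theorem bisimClass_frame (c : Component ob (Tm ob)) (P : Proc ob) :
    (c.frame P).bisimClass = c.label.classFrame P.bisimClass := by
  cases c <;> rfl

theorem bisimClass_residual (c : Component ob (Tm ob)) {R P Q : Proc ob} (hR : SC R (.par P Q)) :
    (c.residual R).bisimClass = (c.residual P).bisimClass + c.label.classFrame Q.bisimClass := by
  rw [← c.bisimClass_frame, ← Tm.bisimClass_par]
  exact ((residual_congr rfl hR).trans (c.residual_par_left P Q)).bisimClass_eq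

end Component

/-- Transitions of classes of processes: some representative has a top-level component that gives
rise to the observation `l`. -/
def BisimClass.Tr (l : Component ob (BisimClass ob)) (x x' : BisimClass ob .proc) : Prop :=
  ∃ (P : Proc ob) (c : Component ob (Tm ob)) (P' : Proc ob), SC P (.par c.toTm P') ∧
    P.bisimClass = x ∧ c.label = l ∧ (c.residual P').bisimClass = x'

theorem BisimClass.Tr.exists_component {l : Component ob (BisimClass ob)} {P : Proc ob}
    {x : BisimClass ob .proc} (h : BisimClass.Tr l P.bisimClass x) :
    ∃ (c : Component ob (Tm ob)) (P' : Proc ob),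
      SC P (.par c.toTm P') ∧ c.label = l ∧ (c.residual P').bisimClass = x := by
  obtain ⟨Q, d, Q', hQ, hPQ, rfl, rfl⟩ := h
  obtain ⟨c, P', hP, hm, hres⟩ := (Tm.bisimClass_eq_iff.1 hPQ).component hQ
  exact ⟨c, P', hP, hm.label_eq.symm, Tm.bisimClass_eq_iff.2 hres.symm⟩

variable (ob) in
/-- The monoid of processes modulo bisimilarity, with their observations as transitions. -/
noncomputable def decompositionSystem :
    DecompositionSystem (BisimClass ob .proc) (Component ob (BisimClass ob)) where
  weight := BisimClass.size
  Tr := BisimClass.Tr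
  frame := Component.classFrame
  retract := Component.classRetract
  eq_zero_of_weight_eq_zero := BisimClass.eq_zero_of_size_eq_zero
  weight_retract l x := by
    cases l with
    | inp => exact BisimClass.size_rename _ x
    | _ => rfl
  retract_frame l x := by
    cases l with
    | inp => exact BisimClass.rename_cons_rename_shift _ _ x
    | _ => rfl
  weight_lt := by
    rintro _ _ _ ⟨P, c, P', hP, rfl, rfl, rfl⟩
    rw [BisimClass.size_bisimClass, BisimClass.size_bisimClass, hP.size_eq_add]
    exact c.size_residual_lt P'
  exists_tr {x} hx := by
    induction x using BisimClass.ind with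
    | h P =>
      rcases P.sc_nil_or_component with h0 | ⟨c, P', hP⟩
      · exact absurd h0.bisimClass_eq hx
      · exact ⟨_, _, P, c, P', hP, rfl, rfl, rfl⟩
  tr_add_right := by
    rintro _ _ _ ⟨P, c, P', hP, rfl, rfl, rfl⟩
    exact BisimClass.ind fun Q =>
      ⟨.par P Q, c, .par P' Q, hP.pull_left Q, rfl, rfl, c.bisimClass_residual (.refl _)⟩
  tr_add {l x y z} hz := by
    induction x using BisimClass.ind with
    | h P =>
    induction y using BisimClass.ind with
    | h Q =>
    rw [← Tm.bisimClass_par] at hz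
    obtain ⟨c, R, hPQ, rfl, rfl⟩ := hz.exists_component
    rcases hPQ.par_split with ⟨P', hP', hR⟩ | ⟨Q', hQ', hR⟩
    · exact .inl ⟨_, ⟨P, c, P', hP', rfl, rfl, rfl⟩, c.bisimClass_residual hR⟩
    · exact .inr ⟨_, ⟨Q, c, Q', hQ', rfl, rfl, rfl⟩,
        c.bisimClass_residual (hR.trans (.par_comm _ _))⟩

theorem isPrime_iff_addIrreducible (P : Proc ob) : IsPrime P ↔ AddIrreducible P.bisimClass := by
  have eq_zero_iff (Q : Proc ob) : Q.bisimClass = 0 ↔ Bisim Q .nil := Tm.bisimClass_eq_iff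
  rw [(decompositionSystem ob).addIrreducible_iff, IsPrime, ne_eq, eq_zero_iff]
  refine and_congr_right' ⟨fun h => ?_, fun h P₁ P₂ hP => ?_⟩
  · refine BisimClass.ind fun P₁ => BisimClass.ind fun P₂ hP => ?_
    rw [eq_zero_iff, eq_zero_iff]
    exact h P₁ P₂ (Tm.bisimClass_eq_iff.1 hP)
  · rw [← eq_zero_iff, ← eq_zero_iff]
    exact h (Tm.bisimClass_eq_iff.2 hP)

theorem bisimClass_parList (L : List (Proc ob)) :
    (parList L).bisimClass = (L.map Tm.bisimClass).sum := by
  induction L with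
  | nil => rfl
  | cons P L ih =>
    cases L with
    | nil => simp only [parList, List.map_cons, List.map_nil, List.sum_cons, List.sum_nil, add_zero]
    | cons Q L => rw [parList, Tm.bisimClass_par, ih, List.map_cons (l := Q :: L), List.sum_cons]

theorem isPrimeDecomposition_iff (P : Proc ob) {n : ℕ} (Ps : Fin n → Proc ob) :
    IsPrimeDecomposition P Ps ↔ (∀ i, AddIrreducible (Ps i).bisimClass) ∧
      P.bisimClass = ∑ i, (Ps i).bisimClass := by
  simp only [IsPrimeDecomposition, isPrime_iff_addIrreducible, ← Tm.bisimClass_eq_iff,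
    bisimClass_parList, List.map_ofFn, List.sum_ofFn, Function.comp_apply]

theorem exists_isPrimeDecomposition (P : Proc ob) :
    ∃ (n : ℕ) (Ps : Fin n → Proc ob), IsPrimeDecomposition P Ps := by
  obtain ⟨s, hs, hsum⟩ :=
    (decompositionSystem ob).exists_addIrreducible_decomposition P.bisimClass
  obtain ⟨L, rfl⟩ : ∃ L : List (Proc ob), (L.map Tm.bisimClass : Multiset _) = s := by
    obtain ⟨s', rfl⟩ :=
      Multiset.map_surjective_of_surjective (f := Tm.bisimClass) Quotient.exists_rep s
    exact ⟨s'.toList, by rw [← Multiset.map_coe, Multiset.coe_toList]⟩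
  refine ⟨L.length, L.get, fun i => ?_, ?_⟩
  · exact (isPrime_iff_addIrreducible _).2 (hs _ (List.mem_map_of_mem (L.get_mem i)))
  · rw [List.ofFn_get, ← Tm.bisimClass_eq_iff, bisimClass_parList, ← hsum, Multiset.sum_coe]

theorem exists_equiv_of_map_univ_val_eq {α β γ : Type*} [Fintype α] [Fintype β] {f : α → γ}
    {g : β → γ} (h : Finset.univ.val.map f = Finset.univ.val.map g) :
    ∃ σ : α ≃ β, ∀ a, f a = g (σ a) := by
  classical
  have card_fiber_eq (c : γ) : Fintype.card {a // f a = c} = Fintype.card {b // g b = c} := by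
    rw [Fintype.card_subtype, Fintype.card_subtype]
    have hcount := congrArg (Multiset.count c) h
    simp only [Multiset.count_map, eq_comm (a := c)] at hcount
    exact hcount
  exact ⟨Equiv.ofFiberEquiv fun c => Fintype.equivOfCardEq (card_fiber_eq c),
    fun a => (Equiv.ofFiberEquiv_map _ a).symm⟩

theorem IsPrimeDecomposition.exists_equiv {P : Proc ob} {n m : ℕ} {Ps : Fin n → Proc ob}
    {Qs : Fin m → Proc ob} (hP : IsPrimeDecomposition P Ps) (hQ : IsPrimeDecomposition P Qs) :
    ∃ σ : Fin n ≃ Fin m, ∀ i, Bisim (Ps i) (Qs (σ i)) := by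
  rw [isPrimeDecomposition_iff] at hP hQ
  have heq : Finset.univ.val.map (fun i => (Ps i).bisimClass) =
      Finset.univ.val.map (fun i => (Qs i).bisimClass) :=
    (decompositionSystem ob).eq_of_sum_eq (by simpa using hP.1) (by simpa using hQ.1)
      (hP.2.symm.trans hQ.2)
  obtain ⟨σ, hσ⟩ := exists_equiv_of_map_univ_val_eq heq
  exact ⟨σ, fun i => Tm.bisimClass_eq_iff.1 (hσ i)⟩

end Decomposition

end HOmp

theorem mainTheorem8 {S : Type u} (ob : S → HOmp.Ty S) (P : HOmp.Proc ob) :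
    (∃ (n : ℕ) (Ps : Fin n → HOmp.Proc ob), HOmp.IsPrimeDecomposition P Ps) ∧
    ∀ (n m : ℕ) (Ps : Fin n → HOmp.Proc ob) (Qs : Fin m → HOmp.Proc ob),
      HOmp.IsPrimeDecomposition P Ps → HOmp.IsPrimeDecomposition P Qs →
        ∃ (h : n = m) (σ : Equiv.Perm (Fin n)),
          ∀ i : Fin n, HOmp.Bisim (Ps i) (Qs (Fin.cast h (σ i))) := by
  refine ⟨HOmp.exists_isPrimeDecomposition P, fun n m Ps Qs hPs hQs => ?_⟩
  obtain ⟨σ, hσ⟩ := hPs.exists_equiv hQs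
  obtain rfl : n = m := Fin.equiv_iff_eq.1 ⟨σ⟩
  exact ⟨rfl, σ, hσ⟩
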